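/- Let $L\ge 1$, $K\ge 2$, and let $X_1,X_2,\dots$ be i.i.d. random vectors in $\mathbb R^L$, $X_j=(X_{j,1},\dots,X_{j,L})'$, such that the c.d.f. $F_\ell$ of $X_{1,\ell}$ is continuous for every $\ell$. Assume that the $L\times L$ matrix $\Sigma$ with entries $\Sigma_{\ell\ell'}=\operatorname{Cov}(F_\ell(X_{1,\ell}),F_{\ell'}(X_{1,\ell'}))$ is invertible. For every $n$ let integers $0=n_0\le n_1\le\dots\le n_{K-1}\le n_K=n$ (depending on $n$) be given, and assume that for $k=0,\dots,K-1$ there is $\lambda_{k+1}\in(0,1)$ such that $(n_{k+1}-n_k)/n\to\lambda_{k+1}$ as $n\to\infty$. Let $R_j^{(\ell)}=\sum_{i=1}^n\mathbf 1_{\{X_{i,\ell}\le X_{j,\ell}\}}$ be the rank of $X_{j,\ell}$ among $X_{1,\ell},\dots,X_{n,\ell}$. For $k=0,\dots,K-1$ let $\bar R_k\in\mathbb R^L$ be the vector with coordinates $$\frac1{n_{k+1}-n_k}\sum_{j=n_k+1}^{n_{k+1}}R_j^{(\ell)}-\frac n2,\qquad \ell=1,\dots,L,$$ let $\hat\Sigma_n$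 be the $L\times L$ matrix with entries $$\hat\Sigma_{n,\ell\ell'}=\frac1{n^3}\sum_{i=1}^n\Bigl(R_i^{(\ell)}-\frac n2\Bigr)\Bigl(R_i^{(\ell')}-\frac n2\Bigr)=\frac1n\sum_{i=1}^n\Bigl(\frac{R_i^{(\ell)}}n-\frac12\Bigr)\Bigl(\frac{R_i^{(\ell')}}n-\frac12\Bigr),$$ and let $$T(n_1,\dots,n_{K-1})=\frac1{n^2}\sum_{k=0}^{K-1}(n_{k+1}-n_k)\,\bar R_k'\,\hat\Sigma_n^{-1}\,\bar R_k,$$ where $\hat\Sigma_n^{-1}$ is read as $0$ if $\hat\Sigma_n$ is singular, and the inverse of $n_{k+1}-n_k$ is read as $0$ if $n_{k+1}=n_k$. Then, as $n\to\infty$, $T(n_1,\dots,n_{K-1})$ converges in distribution to the chi-square distribution $\chi^2((K-1)L)$ with $(K-1)L$ degrees of freedom. -/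

import Mathlib

open MeasureTheory ProbabilityTheory Filter Matrix

noncomputable section

/-- The chi-square distribution with `d` degrees of freedom: the law of the sum of the squares of
`d` independent standard Gaussian variables (for `d = 0` it is the Dirac mass at `0`). -/
def chiSquared (d : ℕ) : Measure ℝ :=
  (Measure.pi fun _ : Fin d => gaussianReal 0 1).map fun z => ∑ i, z i ^ 2

instance isProbabilityMeasure_chiSquared (d : ℕ) : IsProbabilityMeasure (chiSquared d) :=
  Measure.isProbabilityMeasure_map (Measurable.aemeasurable (by fun_prop))

/-- The rank of the `j`-th observation among the first `n` ones, in coordinate `l`.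
Observations are numbered from `0`, so the first `n` ones are `x 0, …, x (n - 1)`. -/
def coordRank {L : ℕ} (n : ℕ) (x : ℕ → Fin L → ℝ) (j : ℕ) (l : Fin L) : ℝ :=
  ∑ k ∈ Finset.range n, if x k l ≤ x j l then 1 else 0

/-- The vector, over the coordinates `l`, of the average rank of the observations numbered
`a, …, b - 1`, centred by `n / 2`. -/
def centredRankMean {L : ℕ} (n : ℕ) (x : ℕ → Fin L → ℝ) (a b : ℕ) : Fin L → ℝ := fun l =>
  ((b : ℝ) - a)⁻¹ * (∑ j ∈ Finset.Ico a b, coordRank n x j l) - (n : ℝ) / 2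

/-- The empirical rank covariance matrix of the first `n` observations, that is the average over the
observations of the products of the `coordRank / n - 1 / 2`. -/
def rankCov {L : ℕ} (n : ℕ) (x : ℕ → Fin L → ℝ) : Matrix (Fin L) (Fin L) ℝ :=
  Matrix.of fun l l' => (1 / (n : ℝ) ^ 3) * ∑ i ∈ Finset.range n,
    (coordRank n x i l - (n : ℝ) / 2) * (coordRank n x i l' - (n : ℝ) / 2)

/-- The multivariate Kruskal–Wallis statistic of the first `n` observations, for the `K` groups
delimited by `c 0, …, c K`: group `k` holds the observations numbered `c k, …, c (k + 1) - 1`. -/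
def kruskalWallis {L K : ℕ} (n : ℕ) (c : Fin (K + 1) → ℕ) (x : ℕ → Fin L → ℝ) : ℝ :=
  (1 / (n : ℝ) ^ 2) * ∑ k : Fin K, ((c k.succ : ℝ) - c k.castSucc) *
    (centredRankMean n x (c k.castSucc) (c k.succ) ⬝ᵥ
      ((rankCov n x)⁻¹ *ᵥ centredRankMean n x (c k.castSucc) (c k.succ)))

/-- The matrix with entries `Cov (F_l (Y_l), F_l' (Y_l'))`, where `F_l` is the cumulative
distribution function of the coordinate `Y_l` of the random vector `Y`. -/
def gradeCov {Ω : Type*} [MeasurableSpace Ω] {L : ℕ} (P : Measure Ω) (Y : Ω → Fin L → ℝ) :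
    Matrix (Fin L) (Fin L) ℝ :=
  Matrix.of fun l l' => covariance
    (fun ω => cdf (P.map fun ω' => Y ω' l) (Y ω l))
    (fun ω => cdf (P.map fun ω' => Y ω' l') (Y ω l')) P

end

/-! Let `F` be the distribution function of a coordinate and `F(X) - 1/2` its centred grade, which
has mean zero because `F` is continuous. A comparison splits as `1{x ≤ y} = 1/2 + (F(y) - 1/2) -
(F(x) - 1/2) + h(x, y)`, where `h` has mean zero in each variable separately. Summing over the ranks
of a group of size `m_k` writes `√m_k / n` times its centred rank mean as `S_k - p_k ∑ p_j S_j` plus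
a remainder, where `S_k` is the group's sum of grades divided by `√m_k` and `p_k = √(m_k / n)`
(`normalized_centredRankMean_eq`). Up to the remainder, the rank means are therefore the group sums
with their component along the unit vector `p` removed.

The remainder is negligible: two values of `h` at off-diagonal index pairs are uncorrelated unless
the pairs agree up to order, so a sum of `m_k n` terms has second moment of order `m_k n` only
(`integral_sq_sum_degenerateComparison_le`). A rank divided by `n` is within order `n^(-1/2)` of its
grade in quadratic mean, so the law of large numbers for products of grades makes the rank
covariance consistent (`tendstoInMeasure_rankCov`), and inversion is continuous at an invertible
`Σ`.

Write `Σ = B Bᵀ`. The vectors `B⁻¹ (F(X) - 1/2)` have identity covariance, and since the groups are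
disjoint their normalized sums converge jointly to a standard Gaussian `K × L` array
(`tendstoInDistribution_groupSums`). By Slutsky's theorem and `Bᵀ Σ⁻¹ B = 1`, the statistic
converges to the squared norm of the projection of this array onto the arrays whose columns are
orthogonal to `√λ`. That space has dimension `(K - 1) L`, and the projected Gaussian is standard on
it (`map_residual_stdGaussian`). -/

/-! ### Convergence in probability and in distribution -/

/-- Convergence to zero in quadratic mean implies convergence to zero in probability. -/
theorem tendstoInMeasure_zero_of_tendsto_integral_sq {Ω : Type*} [MeasurableSpace Ω]
    {P : Measure Ω} [IsProbabilityMeasure P] {Y : ℕ → Ω → ℝ}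
    (hint : ∀ᶠ n in atTop, Integrable (fun ω => Y n ω ^ 2) P)
    (hlim : Tendsto (fun n => ∫ ω, Y n ω ^ 2 ∂P) atTop (nhds 0)) :
    TendstoInMeasure P Y atTop (fun _ => 0) := by
  rw [tendstoInMeasure_iff_measureReal_norm]
  intro ε hε
  have hlim' : Tendsto (fun n => (∫ ω, Y n ω ^ 2 ∂P) / ε ^ 2) atTop (nhds 0) := by
    simpa using hlim.div_const (ε ^ 2)
  refine tendsto_of_tendsto_of_tendsto_of_le_of_le' tendsto_const_nhds hlim'
    (Eventually.of_forall fun _ => measureReal_nonneg) ?_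
  filter_upwards [hint] with n hn
  rw [le_div_iff₀ (by positivity), mul_comm]
  have h := mul_meas_ge_le_integral_of_nonneg (Eventually.of_forall fun ω => sq_nonneg (Y n ω))
    hn (ε ^ 2)
  refine le_trans (mul_le_mul_of_nonneg_left ?_ (by positivity)) h
  refine measureReal_mono fun ω hω => ?_
  simp only [sub_zero, Real.norm_eq_abs, Set.mem_ofPred_eq] at hω ⊢
  rw [← sq_abs (Y n ω)]
  gcongr

/-- A family of random vectors converges in probability as soon as its coordinates do. -/
theorem TendstoInMeasure.pi {Ω ι κ : Type*} [MeasurableSpace Ω] {P : Measure Ω} [Fintype ι]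
    {E : ι → Type*} [∀ i, PseudoEMetricSpace (E i)] {l : Filter κ} {Y : κ → Ω → ∀ i, E i}
    {Z : Ω → ∀ i, E i}
    (h : ∀ i, TendstoInMeasure P (fun n ω => Y n ω i) l (fun ω => Z ω i)) :
    TendstoInMeasure P Y l Z := by
  intro ε hε
  have hsum : Tendsto (fun n => ∑ i, P {ω | ε ≤ edist (Y n ω i) (Z ω i)}) l (nhds 0) := by
    simpa using tendsto_finsetSum Finset.univ fun i _ => h i ε hε
  refine tendsto_of_tendsto_of_tendsto_of_le_of_le tendsto_const_nhds hsum
    (fun _ => zero_le) fun n => ?_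
  refine (measure_mono ?_).trans (measure_iUnion_fintype_le P _)
  intro ω hω
  simp only [Set.mem_ofPred_eq, Set.mem_iUnion, edist_pi_def] at hω ⊢
  by_contra! hlt
  exact absurd hω (not_le.2 ((Finset.sup_lt_iff hε).2 fun i _ => hlt i))

/-- Convergence in probability of the two components of a pair. -/
theorem TendstoInMeasure.prodMk {Ω κ E F : Type*} [MeasurableSpace Ω] {P : Measure Ω}
    [PseudoEMetricSpace E] [PseudoEMetricSpace F] {l : Filter κ} {Y : κ → Ω → E}
    {Z : κ → Ω → F} {y : Ω → E} {z : Ω → F}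
    (hY : TendstoInMeasure P Y l y) (hZ : TendstoInMeasure P Z l z) :
    TendstoInMeasure P (fun n ω => (Y n ω, Z n ω)) l (fun ω => (y ω, z ω)) := by
  intro ε hε
  have hsum := (hY ε hε).add (hZ ε hε)
  rw [add_zero] at hsum
  refine tendsto_of_tendsto_of_tendsto_of_le_of_le tendsto_const_nhds hsum
    (fun _ => zero_le) fun n => ?_
  refine (measure_mono ?_).trans (measure_union_le _ _)
  intro ω hω
  simpa [Prod.edist_eq] using hω

/-- A map continuous at a constant limit preserves convergence in probability. -/
theorem TendstoInMeasure.continuousAt_comp {Ω κ E F : Type*} [MeasurableSpace Ω] {P : Measure Ω}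
    [PseudoEMetricSpace E] [PseudoEMetricSpace F] {l : Filter κ} {Y : κ → Ω → E} {y : E}
    {f : E → F} (hf : ContinuousAt f y) (hY : TendstoInMeasure P Y l (fun _ => y)) :
    TendstoInMeasure P (fun n ω => f (Y n ω)) l (fun _ => f y) := by
  intro ε hε
  obtain ⟨δ, hδ, hball⟩ := EMetric.continuousAt_iff.1 hf ε hε
  refine tendsto_of_tendsto_of_tendsto_of_le_of_le tendsto_const_nhds (hY δ hδ)
    (fun _ => zero_le) fun n => measure_mono fun ω hω => ?_
  simp only [Set.mem_ofPred_eq] at hω ⊢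
  by_contra! hlt
  exact absurd hω (not_le.2 (hball hlt))

/-- A convergent sequence of constants converges in probability. -/
theorem tendstoInMeasure_const_of_tendsto {Ω κ E : Type*} [MeasurableSpace Ω] {P : Measure Ω}
    [PseudoEMetricSpace E] {l : Filter κ} {a : κ → E} {y : E} (h : Tendsto a l (nhds y)) :
    TendstoInMeasure P (fun n (_ : Ω) => a n) l (fun _ => y) := by
  intro ε hε
  refine tendsto_const_nhds.congr' ?_
  filter_upwards [EMetric.tendsto_nhds.1 h ε hε] with n hn
  simp [not_le.2 hn]

/-- Sums of two real sequences converging in probability to constants. -/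
theorem TendstoInMeasure.add_const {Ω κ : Type*} [MeasurableSpace Ω] {P : Measure Ω}
    {l : Filter κ} {Y Z : κ → Ω → ℝ} {y z : ℝ} (hY : TendstoInMeasure P Y l (fun _ => y))
    (hZ : TendstoInMeasure P Z l (fun _ => z)) :
    TendstoInMeasure P (fun n ω => Y n ω + Z n ω) l (fun _ => y + z) := by
  rw [tendstoInMeasure_iff_norm] at *
  intro ε hε
  have hsum := (hY (ε / 2) (by positivity)).add (hZ (ε / 2) (by positivity))
  rw [add_zero] at hsum
  refine tendsto_of_tendsto_of_tendsto_of_le_of_le tendsto_const_nhds hsum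
    (fun _ => zero_le) fun n => (measure_mono ?_).trans (measure_union_le _ _)
  intro ω hω
  simp only [Set.mem_ofPred_eq, Set.mem_union, Real.norm_eq_abs] at hω ⊢
  by_contra! hlt
  have := abs_add_le (Y n ω - y) (Z n ω - z)
  rw [sub_add_sub_comm] at this
  linarith [hlt.1, hlt.2]

/-- Sequences of random variables that are eventually equal have the same limit in distribution. -/
theorem TendstoInDistribution.congr_eventually {Ω Ω' E : Type*} [MeasurableSpace Ω]
    [MeasurableSpace Ω'] {P : Measure Ω} {P' : Measure Ω'} [IsProbabilityMeasure P]
    [IsProbabilityMeasure P'] [TopologicalSpace E] [MeasurableSpace E] [OpensMeasurableSpace E]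
    {Y Z : ℕ → Ω → E} {W : Ω' → E}
    (h : TendstoInDistribution Y atTop W (fun _ => P) P') (hZ : ∀ n, AEMeasurable (Z n) P)
    (hYZ : ∀ᶠ n in atTop, Y n =ᵐ[P] Z n) :
    TendstoInDistribution Z atTop W (fun _ => P) P' where
  forall_aemeasurable := hZ
  aemeasurable_limit := h.aemeasurable_limit
  tendsto := by
    refine h.tendsto.congr' ?_
    filter_upwards [hYZ] with n hn
    exact Subtype.ext (Measure.map_congr hn)

/-! ### Grades under a continuous distribution function -/

theorem measurable_cdf (μ : Measure ℝ) : Measurable (cdf μ) := (monotone_cdf μ).measurable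

theorem measurable_ite_le : Measurable fun p : ℝ × ℝ => if p.1 ≤ p.2 then (1 : ℝ) else 0 :=
  Measurable.ite (measurableSet_le measurable_fst measurable_snd) measurable_const measurable_const

theorem integral_ite_le_left (μ : Measure ℝ) [IsProbabilityMeasure μ] (y : ℝ) :
    ∫ x, (if x ≤ y then (1 : ℝ) else 0) ∂μ = cdf μ y := by
  rw [cdf_eq_real, ← integral_indicator_one measurableSet_Iic]
  rfl

theorem nullSingletonClass_of_continuous_cdf {μ : Measure ℝ} [IsProbabilityMeasure μ]
    (hμ : Continuous (cdf μ)) : NullSingletonClass μ where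
  measure_singleton a := by
    conv_lhs => rw [← measure_cdf μ]
    rw [StieltjesFunction.measure_singleton, (hμ.continuousAt.continuousWithinAt).leftLim_eq,
      sub_self, ENNReal.ofReal_zero]

/-- Without atoms, `x ≤ y` and `x < y` have the same probability, and the latter event is the
complement of `Iic x`. This is where continuity of the distribution function enters. -/
theorem integral_ite_le_right {μ : Measure ℝ} [IsProbabilityMeasure μ] (hμ : Continuous (cdf μ))
    (x : ℝ) : ∫ y, (if x ≤ y then (1 : ℝ) else 0) ∂μ = 1 - cdf μ x := by
  have := nullSingletonClass_of_continuous_cdf hμ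
  have h : ∫ y, (if x ≤ y then (1 : ℝ) else 0) ∂μ = μ.real (Set.Ici x) := by
    rw [← integral_indicator_one measurableSet_Ici]
    rfl
  rw [h, cdf_eq_real, ← probReal_compl_eq_one_sub measurableSet_Iic, Set.compl_Iic]
  exact measureReal_congr Ioi_ae_eq_Ici.symm

theorem integrable_cdf (μ ν : Measure ℝ) [IsFiniteMeasure ν] : Integrable (fun x => cdf μ x) ν :=
  Integrable.of_bound (C := 1) (measurable_cdf μ).aestronglyMeasurable
    (Eventually.of_forall fun x => by
      rw [Real.norm_eq_abs, abs_of_nonneg (cdf_nonneg μ x)]; exact cdf_le_one μ x)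

/-- A random variable with continuous distribution function has a grade of mean `1 / 2`. -/
theorem integral_cdf {μ : Measure ℝ} [IsProbabilityMeasure μ] (hμ : Continuous (cdf μ)) :
    ∫ x, cdf μ x ∂μ = 1 / 2 := by
  have hint : Integrable (Function.uncurry fun x y : ℝ => if x ≤ y then (1 : ℝ) else 0)
      (μ.prod μ) := by
    refine Integrable.of_bound (C := 1) measurable_ite_le.aestronglyMeasurable
      (Eventually.of_forall fun p => ?_)
    simp only [Function.uncurry]
    split_ifs <;> simp
  -- Integrating `1{x ≤ y}` over `y` first gives `1 - F(x)`, over `x` first gives `F(y)`. Hence the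
  -- mean grade equals one minus itself.
  have h := integral_integral_swap hint
  simp_rw [integral_ite_le_right hμ, integral_ite_le_left] at h
  rw [integral_sub (integrable_const _) (integrable_cdf μ μ)] at h
  simp only [integral_const, probReal_univ, smul_eq_mul, mul_one] at h
  linarith

/-! ### Second moments of sums of centred kernels -/

/-- Products of bounded kernels evaluated at independent variables are uncorrelated when one of
the kernels is centred in a variable that appears nowhere else. -/
theorem integral_kernel_mul_kernel_eq_zero {Ω : Type*} [MeasurableSpace Ω] {P : Measure Ω}
    [IsProbabilityMeasure P] {Y : ℕ → Ω → ℝ} (hindep : iIndepFun Y P)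
    (hY : ∀ i, AEMeasurable (Y i) P) {g φ : ℝ → ℝ → ℝ}
    (hg : Measurable fun p : ℝ × ℝ => g p.1 p.2) (hφ : Measurable fun p : ℝ × ℝ => φ p.1 p.2)
    {C D : ℝ} (hgC : ∀ x y, |g x y| ≤ C) (hφD : ∀ x y, |φ x y| ≤ D) {k i k' i' : ℕ}
    (hki : k ≠ i) (hkk' : k ≠ k') (hki' : k ≠ i')
    (hcent : ∀ y, ∫ x, g x y ∂(P.map (Y k)) = 0) :
    ∫ ω, g (Y k ω) (Y i ω) * φ (Y k' ω) (Y i' ω) ∂P = 0 := by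
  -- The indices `i`, `k'`, `i'` may coincide with one another. Only the independence of `Y k` from
  -- their joint vector is needed, after which `Y k` is integrated out first.
  have hdisj : Disjoint ({k} : Finset ℕ) {i, k', i'} := by simp [hki, hkk', hki']
  have hind : IndepFun (Y k) (fun ω => (Y i ω, Y k' ω, Y i' ω)) P :=
    (hindep.indepFun_finset₀ {k} {i, k', i'} hdisj hY).comp
      (φ := fun v : ({k} : Finset ℕ) → ℝ => v ⟨k, by simp⟩)
      (ψ := fun v : ({i, k', i'} : Finset ℕ) → ℝ =>
        (v ⟨i, by simp⟩, v ⟨k', by simp⟩, v ⟨i', by simp⟩))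
      (by fun_prop) (by fun_prop)
  have hW : AEMeasurable (fun ω => (Y i ω, Y k' ω, Y i' ω)) P :=
    (hY i).prodMk ((hY k').prodMk (hY i'))
  have hmap := hind.map_prod_eq_prod_map_map (hY k) hW
  have := Measure.isProbabilityMeasure_map (hY k)
  have := Measure.isProbabilityMeasure_map hW
  have hF : Measurable fun z : ℝ × ℝ × ℝ × ℝ => g z.1 z.2.1 * φ z.2.2.1 z.2.2.2 :=
    (hg.comp (measurable_fst.prodMk (measurable_fst.comp measurable_snd))).mul
      (hφ.comp (measurable_snd.comp measurable_snd))
  have hC : 0 ≤ C := (abs_nonneg _).trans (hgC 0 0)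
  calc ∫ ω, g (Y k ω) (Y i ω) * φ (Y k' ω) (Y i' ω) ∂P
      = ∫ z, g z.1 z.2.1 * φ z.2.2.1 z.2.2.2 ∂(P.map fun ω => (Y k ω, Y i ω, Y k' ω, Y i' ω)) :=
        (integral_map ((hY k).prodMk hW) hF.aestronglyMeasurable).symm
    _ = ∫ w, ∫ x, g x w.1 * φ w.2.1 w.2.2 ∂(P.map (Y k))
          ∂(P.map fun ω => (Y i ω, Y k' ω, Y i' ω)) := by
        rw [hmap, integral_prod_symm]
        refine Integrable.of_bound (C := C * D) hF.aestronglyMeasurable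
          (Eventually.of_forall fun z => ?_)
        rw [Real.norm_eq_abs, abs_mul]
        exact mul_le_mul (hgC _ _) (hφD _ _) (abs_nonneg _) hC
    _ = 0 := by simp [integral_mul_const, hcent]

/-- The second moment of a finite sum of bounded variables, when all but a few pairs are
uncorrelated. -/
theorem integral_sq_sum_le {Ω ι : Type*} [MeasurableSpace Ω] {P : Measure Ω}
    [IsProbabilityMeasure P] {Z : ι → Ω → ℝ} (s : Finset ι) (hZ : ∀ i, AEMeasurable (Z i) P)
    {C : ℝ} (hC : ∀ i ω, |Z i ω| ≤ C) (b : ι → ι → ℝ) (hb : ∀ i j, 0 ≤ b i j)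
    (hcorr : ∀ i j, b i j < 1 → ∫ ω, Z i ω * Z j ω ∂P = 0) :
    ∫ ω, (∑ i ∈ s, Z i ω) ^ 2 ∂P ≤ C ^ 2 * ∑ i ∈ s, ∑ j ∈ s, b i j := by
  have hbd : ∀ i j ω, ‖Z i ω * Z j ω‖ ≤ C ^ 2 := fun i j ω => by
    rw [Real.norm_eq_abs, abs_mul, sq]
    exact mul_le_mul (hC i ω) (hC j ω) (abs_nonneg _) ((abs_nonneg _).trans (hC i ω))
  have hint : ∀ i j, Integrable (fun ω => Z i ω * Z j ω) P := fun i j =>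
    Integrable.of_bound ((hZ i).mul (hZ j)).aestronglyMeasurable (C ^ 2)
      (Eventually.of_forall (hbd i j))
  simp_rw [sq (Finset.sum _ _), Finset.sum_mul_sum]
  rw [integral_finsetSum _ fun i _ => integrable_finsetSum _ fun j _ => hint i j, Finset.mul_sum]
  refine Finset.sum_le_sum fun i _ => ?_
  rw [integral_finsetSum _ fun j _ => hint i j, Finset.mul_sum]
  refine Finset.sum_le_sum fun j _ => ?_
  by_cases h : b i j < 1
  · rw [hcorr i j h]
    exact mul_nonneg (sq_nonneg _) (hb i j)
  · refine (le_abs_self _).trans ?_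
    have h1 := norm_integral_le_of_norm_le_const (μ := P) (Eventually.of_forall (hbd i j))
    rw [probReal_univ, mul_one, Real.norm_eq_abs] at h1
    exact h1.trans (le_mul_of_one_le_right (sq_nonneg _) (not_lt.1 h))

/-- The difference between a comparison and its conditional expectation given the larger
variable. -/
noncomputable def comparisonGap (μ : Measure ℝ) (x y : ℝ) : ℝ := (if x ≤ y then 1 else 0) - cdf μ y

/-- The completely degenerate part of the comparison kernel. -/
noncomputable def degenerateComparison (μ : Measure ℝ) (x y : ℝ) : ℝ :=
  (if x ≤ y then 1 else 0) - cdf μ y + cdf μ x - 1 / 2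

theorem measurable_comparisonGap (μ : Measure ℝ) :
    Measurable fun p : ℝ × ℝ => comparisonGap μ p.1 p.2 :=
  measurable_ite_le.sub ((measurable_cdf μ).comp measurable_snd)

theorem measurable_degenerateComparison (μ : Measure ℝ) :
    Measurable fun p : ℝ × ℝ => degenerateComparison μ p.1 p.2 :=
  ((measurable_ite_le.sub ((measurable_cdf μ).comp measurable_snd)).add
    ((measurable_cdf μ).comp measurable_fst)).sub_const _

theorem abs_comparisonGap_le (μ : Measure ℝ) (x y : ℝ) : |comparisonGap μ x y| ≤ 1 := by
  rw [comparisonGap, abs_le]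
  have h0 := cdf_nonneg μ y
  have h1 := cdf_le_one μ y
  split_ifs <;> constructor <;> linarith

theorem abs_degenerateComparison_le (μ : Measure ℝ) (x y : ℝ) :
    |degenerateComparison μ x y| ≤ 2 := by
  rw [degenerateComparison, abs_le]
  have h0 := cdf_nonneg μ y
  have h1 := cdf_le_one μ y
  have h2 := cdf_nonneg μ x
  have h3 := cdf_le_one μ x
  split_ifs <;> constructor <;> linarith

theorem integrable_ite_le_left (μ : Measure ℝ) [IsFiniteMeasure μ] (y : ℝ) :
    Integrable (fun x => if x ≤ y then (1 : ℝ) else 0) μ :=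
  Integrable.of_bound (C := 1)
    (measurable_ite_le.comp (measurable_id.prodMk measurable_const)).aestronglyMeasurable
    (Eventually.of_forall fun x => by split_ifs <;> simp)

theorem integrable_ite_le_right (μ : Measure ℝ) [IsFiniteMeasure μ] (x : ℝ) :
    Integrable (fun y => if x ≤ y then (1 : ℝ) else 0) μ :=
  Integrable.of_bound (C := 1)
    (measurable_ite_le.comp (measurable_const.prodMk measurable_id)).aestronglyMeasurable
    (Eventually.of_forall fun y => by split_ifs <;> simp)

theorem integral_comparisonGap (μ : Measure ℝ) [IsProbabilityMeasure μ] (y : ℝ) :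
    ∫ x, comparisonGap μ x y ∂μ = 0 := by
  simp only [comparisonGap]
  rw [integral_sub (integrable_ite_le_left μ y) (integrable_const _), integral_ite_le_left]
  simp

/-- The comparison has mean `F(y)` given the second variable, which cancels, leaving the mean grade
minus `1 / 2`. Given the first variable its mean is `1 - F(x)`, and the same cancellation works.
This double centring is what makes the double sum of ranks small. -/
theorem integral_degenerateComparison_left {μ : Measure ℝ} [IsProbabilityMeasure μ]
    (hμ : Continuous (cdf μ)) (y : ℝ) : ∫ x, degenerateComparison μ x y ∂μ = 0 := by
  simp only [degenerateComparison]
  rw [integral_sub _ (integrable_const _), integral_add _ (integrable_cdf μ μ),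
    integral_sub (integrable_ite_le_left μ y) (integrable_const _), integral_ite_le_left,
    integral_cdf hμ]
  · simp
  · exact (integrable_ite_le_left μ y).sub (integrable_const _)
  · exact ((integrable_ite_le_left μ y).sub (integrable_const _)).add (integrable_cdf μ μ)

theorem integral_degenerateComparison_right {μ : Measure ℝ} [IsProbabilityMeasure μ]
    (hμ : Continuous (cdf μ)) (x : ℝ) : ∫ y, degenerateComparison μ x y ∂μ = 0 := by
  simp only [degenerateComparison]
  rw [integral_sub _ (integrable_const _), integral_add _ (integrable_const _),
    integral_sub (integrable_ite_le_right μ x) (integrable_cdf μ μ), integral_ite_le_right hμ,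
    integral_cdf hμ]
  · simp only [integral_const, probReal_univ, smul_eq_mul, one_mul]
    ring
  · exact (integrable_ite_le_right μ x).sub (integrable_cdf μ μ)
  · exact ((integrable_ite_le_right μ x).sub (integrable_cdf μ μ)).add (integrable_const _)

/-- The empirical distribution function at an observation is close to its grade in quadratic
mean. -/
theorem integral_sq_sum_comparisonGap_le {Ω : Type*} [MeasurableSpace Ω] {P : Measure Ω}
    [IsProbabilityMeasure P] {Y : ℕ → Ω → ℝ} (hindep : iIndepFun Y P)
    (hY : ∀ i, AEMeasurable (Y i) P) {μ : Measure ℝ} (hlaw : ∀ i, P.map (Y i) = μ)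
    (n i : ℕ) :
    ∫ ω, (∑ k ∈ Finset.range n, comparisonGap μ (Y k ω) (Y i ω)) ^ 2 ∂P ≤ 2 * n := by
  have : IsProbabilityMeasure μ := hlaw 0 ▸ Measure.isProbabilityMeasure_map (hY 0)
  refine (integral_sq_sum_le (C := 1) (Finset.range n)
    (fun k => (measurable_comparisonGap μ).comp_aemeasurable ((hY k).prodMk (hY i)))
    (fun k ω => abs_comparisonGap_le μ _ _)
    -- If `k` differs from both `i` and `k'`, then `Y k` occurs in the first factor only, which is
    -- centred in it, even when `k' = i`. The two exceptional cases account for at most `n` pairs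
    -- each.
    (fun k k' => (if k = k' then 1 else 0) + (if k = i then 1 else 0))
    (fun k k' => by positivity) fun k k' h => ?_).trans ?_
  · have hk : k ≠ i ∧ k ≠ k' := by
      constructor <;> rintro rfl <;> revert h <;> simp <;> positivity
    exact integral_kernel_mul_kernel_eq_zero hindep hY (measurable_comparisonGap μ)
      (measurable_comparisonGap μ) (abs_comparisonGap_le μ) (abs_comparisonGap_le μ) hk.1 hk.2 hk.1
      (hlaw k ▸ integral_comparisonGap μ)
  · have h1 : ∑ k ∈ Finset.range n, ∑ k' ∈ Finset.range n, (if k = k' then (1 : ℝ) else 0) = n := by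
      rw [Finset.sum_congr rfl fun k hk => by rw [Finset.sum_ite_eq, if_pos hk]]
      simp
    have h2 : ∑ k ∈ Finset.range n, ∑ _k' ∈ Finset.range n, (if k = i then (1 : ℝ) else 0) ≤ n := by
      simp only [Finset.sum_const, Finset.card_range, nsmul_eq_mul, ← Finset.mul_sum,
        Finset.sum_ite_eq']
      split_ifs <;> simp
    simp only [Finset.sum_add_distrib]
    linarith

/-- The second moment of the degenerate part of a partial sum of ranks. -/
theorem integral_sq_sum_degenerateComparison_le {Ω : Type*} [MeasurableSpace Ω] {P : Measure Ω}
    [IsProbabilityMeasure P] {Y : ℕ → Ω → ℝ} (hindep : iIndepFun Y P)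
    (hY : ∀ i, AEMeasurable (Y i) P) {μ : Measure ℝ} (hlaw : ∀ i, P.map (Y i) = μ)
    (hμ : Continuous (cdf μ)) (n : ℕ) {G : Finset ℕ} (hG : G.card ≤ n) :
    ∫ ω, (∑ j ∈ G, ∑ i ∈ Finset.range n, degenerateComparison μ (Y i ω) (Y j ω)) ^ 2 ∂P
      ≤ 12 * (G.card * n) := by
  have : IsProbabilityMeasure μ := hlaw 0 ▸ Measure.isProbabilityMeasure_map (hY 0)
  have hmeas := measurable_degenerateComparison μ
  have habs := abs_degenerateComparison_le μ
  have hleft : ∀ k, ∀ y, ∫ x, degenerateComparison μ x y ∂(P.map (Y k)) = 0 := fun k => by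
    rw [hlaw k]
    exact integral_degenerateComparison_left hμ
  have hright : ∀ k, ∀ x, ∫ y, degenerateComparison μ x y ∂(P.map (Y k)) = 0 := fun k => by
    rw [hlaw k]
    exact integral_degenerateComparison_right hμ
  have hfirst : ∀ p q : ℕ × ℕ, p.2 ≠ p.1 → p.2 ≠ q.1 → p.2 ≠ q.2 →
      ∫ ω, degenerateComparison μ (Y p.2 ω) (Y p.1 ω) *
        degenerateComparison μ (Y q.2 ω) (Y q.1 ω) ∂P = 0 := fun p q h1 h2 h3 =>
    integral_kernel_mul_kernel_eq_zero hindep hY hmeas hmeas habs habs h1 h3 h2 (hleft _)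
  have hsecond : ∀ p q : ℕ × ℕ, p.1 ≠ p.2 → p.1 ≠ q.1 → p.1 ≠ q.2 →
      ∫ ω, degenerateComparison μ (Y p.2 ω) (Y p.1 ω) *
        degenerateComparison μ (Y q.2 ω) (Y q.1 ω) ∂P = 0 := fun p q h1 h2 h3 =>
    integral_kernel_mul_kernel_eq_zero (g := fun y x => degenerateComparison μ x y) hindep hY
      (hmeas.comp measurable_swap) hmeas (fun _ _ => habs _ _) habs h1 h3 h2 (hright _)
  -- If the two distinct indices of `p` both occurred in `q`, then `p` would be `q` or its swap. So
  -- one of them is absent from `q`, and the kernel is centred in that variable.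
  have hoff : ∀ p q : ℕ × ℕ, p.1 ≠ p.2 → p ≠ q → p ≠ q.swap →
      ∫ ω, degenerateComparison μ (Y p.2 ω) (Y p.1 ω) *
        degenerateComparison μ (Y q.2 ω) (Y q.1 ω) ∂P = 0 := by
    rintro ⟨a, b⟩ ⟨c, d⟩ h1 h2 h3
    simp only [Prod.swap, ne_eq, Prod.mk.injEq, not_and] at h1 h2 h3
    by_cases hb : b ≠ c ∧ b ≠ d
    · exact hfirst (a, b) (c, d) (Ne.symm h1) hb.1 hb.2
    · refine hsecond (a, b) (c, d) h1 ?_ ?_ <;> dsimp only <;> grind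
  simp_rw [← Finset.sum_product' G (Finset.range n)
    fun j i => degenerateComparison μ (Y i _) (Y j _)]
  refine (integral_sq_sum_le (C := 2) (G ×ˢ Finset.range n)
    (Z := fun (p : ℕ × ℕ) ω => degenerateComparison μ (Y p.2 ω) (Y p.1 ω))
    (fun p => hmeas.comp_aemeasurable ((hY p.2).prodMk (hY p.1)))
    (fun p ω => habs _ _)
    -- The last term is needed because the kernel is not centred on the diagonal, where it equals `1
    -- / 2`. There are at most `G.card ≤ n` diagonal indices, so each of the three terms sums to at
    -- most `G.card * n`. With the bound `2` on the kernel this gives `12 = 2 ^ 2 * 3`.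
    (fun p q => (if p = q then 1 else 0) + (if p.swap = q then 1 else 0) +
      (if p.1 = p.2 then 1 else 0) * (if q.1 = q.2 then 1 else 0))
    (fun p q => by positivity) fun p q h => ?_).trans ?_
  · have h1 : p ≠ q := by
      rintro rfl
      revert h
      simp only [if_true]
      rw [imp_false, not_lt]
      linarith [show (0 : ℝ) ≤ (if p.swap = p then 1 else 0) +
        (if p.1 = p.2 then 1 else 0) * (if p.1 = p.2 then 1 else 0) by positivity]
    have h2 : p.swap ≠ q := by
      rintro rfl
      revert h
      simp only [if_true]
      rw [imp_false, not_lt]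
      linarith [show (0 : ℝ) ≤ (if p = p.swap then 1 else 0) +
        (if p.1 = p.2 then 1 else 0) * (if p.swap.1 = p.swap.2 then 1 else 0) by positivity]
    have h2' : p ≠ q.swap := fun h => h2 (by rw [h, Prod.swap_swap])
    by_cases hp : p.1 = p.2
    · have hq : q.1 ≠ q.2 := by
        intro hq
        revert h
        rw [if_pos hp, if_pos hq, imp_false, not_lt, if_neg h1, if_neg h2]
        norm_num
      -- Here `p` is diagonal and `q` is not, so the missing index is sought in `q`.
      simp_rw [mul_comm (degenerateComparison μ (Y p.2 _) _)]
      exact hoff q p hq h1.symm h2.symm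
    · exact hoff p q hp h1 h2'
  · have hcard : ((G ×ˢ Finset.range n).card : ℝ) = G.card * n := by
      rw [Finset.card_product, Finset.card_range, Nat.cast_mul]
    have hle : ∀ f : ℕ × ℕ → ℕ × ℕ, ∑ p ∈ G ×ˢ Finset.range n, ∑ q ∈ G ×ˢ Finset.range n,
        (if f p = q then (1 : ℝ) else 0) ≤ G.card * n := fun f => by
      rw [← hcard, ← nsmul_one, ← Finset.sum_const]
      refine Finset.sum_le_sum fun p _ => ?_
      rw [Finset.sum_ite_eq]
      split_ifs <;> norm_num
    have hdiag : ∑ p ∈ G ×ˢ Finset.range n, (if p.1 = p.2 then (1 : ℝ) else 0) ≤ G.card := by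
      rw [Finset.sum_product, ← nsmul_one, ← Finset.sum_const]
      refine Finset.sum_le_sum fun j _ => ?_
      rw [Finset.sum_ite_eq]
      split_ifs <;> norm_num
    have hdiag0 : 0 ≤ ∑ p ∈ G ×ˢ Finset.range n, (if p.1 = p.2 then (1 : ℝ) else 0) :=
      Finset.sum_nonneg fun _ _ => by positivity
    have h3 : (∑ p ∈ G ×ˢ Finset.range n, (if p.1 = p.2 then (1 : ℝ) else 0)) *
        ∑ p ∈ G ×ˢ Finset.range n, (if p.1 = p.2 then (1 : ℝ) else 0) ≤ G.card * n :=
      mul_le_mul hdiag (hdiag.trans (by exact_mod_cast hG)) hdiag0 (by positivity)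
    have h1 := hle id
    simp only [id] at h1
    simp only [Finset.sum_add_distrib, ← Finset.sum_mul_sum]
    linarith [hle Prod.swap]

/-! ### Central limit theorem for group sums -/

/-- The powers of the rescaled characteristic function of a centred square integrable variable
converge to the characteristic function of a centred Gaussian variable. -/
theorem tendsto_charFun_inv_sqrt_pow {Ω : Type*} [MeasurableSpace Ω] {P : Measure Ω}
    [IsProbabilityMeasure P] {Z : ℕ → Ω → ℝ} (hindep : iIndepFun Z P)
    (hident : ∀ i, IdentDistrib (Z i) (Z 0) P P) (hL2 : MemLp (Z 0) 2 P) (hmean : P[Z 0] = 0) :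
    Tendsto (fun n : ℕ => charFun (P.map (Z 0)) (√n)⁻¹ ^ n) atTop
      (nhds (Complex.exp (-(∫ ω, Z 0 ω ^ 2 ∂P : ℝ) / 2))) := by
  have hclt := (tendstoInDistribution_inv_sqrt_mul_sum_sub
    (Y := (id : ℝ → ℝ)) (P' := gaussianReal 0 Var[Z 0; P].toNNReal)
    HasLaw.id hL2 hindep hident).tendsto
  -- At frequency `1` the characteristic function of the normalized sum is exactly the power in
  -- question.
  have h := ProbabilityMeasure.tendsto_iff_tendsto_charFun.1 hclt 1
  simp only [ProbabilityMeasure.coe_mk, hmean, mul_zero, sub_zero, Measure.map_id,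
    charFun_inv_sqrt_mul_sum hindep hident, mul_one, charFun_gaussianReal] at h
  convert h using 2
  rw [variance_eq_integral hL2.aemeasurable, hmean]
  simp only [sub_zero]
  rw [Real.coe_toNNReal _ (integral_nonneg fun ω => sq_nonneg _)]
  simp [neg_div]

/-- Consecutive intervals of natural numbers are disjoint: an element determines its interval. -/
theorem eq_of_mem_Ico_castSucc_succ {K : ℕ} {c : Fin (K + 1) → ℕ} (hc : Monotone c)
    {k k' : Fin K} {j : ℕ} (h : j ∈ Finset.Ico (c k.castSucc) (c k.succ))
    (h' : j ∈ Finset.Ico (c k'.castSucc) (c k'.succ)) : k = k' := by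
  rw [Finset.mem_Ico] at h h'
  by_contra hne
  rcases lt_or_gt_of_ne hne with hlt | hlt
  · have := hc (Fin.succ_le_castSucc_iff.2 hlt)
    omega
  · have := hc (Fin.succ_le_castSucc_iff.2 hlt)
    omega

/-- The array of the normalized sums of a sequence of vectors over consecutive groups. -/
noncomputable def groupSums {K L : ℕ} (c : Fin (K + 1) → ℕ) (v : ℕ → Fin L → ℝ) :
    EuclideanSpace ℝ (Fin K × Fin L) :=
  WithLp.toLp 2 fun i => (√((c i.1.succ - c i.1.castSucc : ℕ) : ℝ))⁻¹ *
    ∑ j ∈ Finset.Ico (c i.1.castSucc) (c i.1.succ), v j i.2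

theorem aemeasurable_groupSums {Ω : Type*} [MeasurableSpace Ω] {P : Measure Ω} {K L : ℕ}
    (c : Fin (K + 1) → ℕ) {V : ℕ → Ω → Fin L → ℝ} (hV : ∀ i, AEMeasurable (V i) P) :
    AEMeasurable (fun ω => groupSums c fun i => V i ω) P := by
  refine (WithLp.measurable_toLp 2 _).comp_aemeasurable (aemeasurable_pi_lambda _ fun i => ?_)
  refine AEMeasurable.const_mul (Finset.aemeasurable_fun_sum _ fun j _ => ?_) _
  exact (measurable_pi_apply i.2).comp_aemeasurable (hV j)

/-- The inner product with `t` is a sum of scalar functions of single observations. Each observation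
belongs to at most one group, so these summands are independent and the characteristic function
factorizes, with equal factors within a group. -/
theorem charFun_groupSums {Ω : Type*} [MeasurableSpace Ω] {P : Measure Ω}
    [IsProbabilityMeasure P] {K L : ℕ} {c : Fin (K + 1) → ℕ} (hc : Monotone c)
    {V : ℕ → Ω → Fin L → ℝ} (hindep : iIndepFun V P) (hident : ∀ i, IdentDistrib (V i) (V 0) P P)
    (t : EuclideanSpace ℝ (Fin K × Fin L)) :
    charFun (P.map fun ω => groupSums c fun i => V i ω) t =
      ∏ k, charFun (P.map fun ω => ∑ l, t (k, l) * V 0 ω l)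
        (√((c k.succ - c k.castSucc : ℕ) : ℝ))⁻¹ ^ (c k.succ - c k.castSucc) := by
  have hV : ∀ i, AEMeasurable (V i) P := fun i => (hident i).aemeasurable_fst
  set a : Fin K → ℝ := fun k => (√((c k.succ - c k.castSucc : ℕ) : ℝ))⁻¹ with ha
  let u : (Σ _ : Fin K, ℕ) → (Fin L → ℝ) → ℝ := fun q v => a q.1 * ∑ l, t (q.1, l) * v l
  have hu : ∀ q, Measurable (u q) := fun q => by fun_prop
  let S : Finset (Σ _ : Fin K, ℕ) :=
    Finset.univ.sigma fun k => Finset.Ico (c k.castSucc) (c k.succ)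
  have hsum : ∀ ω, inner ℝ (groupSums c fun i => V i ω) t = ∑ q ∈ S, u q (V q.2 ω) := fun ω => by
    simp only [S, u, Finset.sum_sigma, groupSums, PiLp.inner_apply, RCLike.inner_apply,
      conj_trivial, Fintype.sum_prod_type, ← Finset.mul_sum, ha]
    refine Finset.sum_congr rfl fun k _ => ?_
    rw [Finset.sum_comm, Finset.mul_sum]
    refine Finset.sum_congr rfl fun l _ => ?_
    rw [← Finset.mul_sum]
    ring
  -- Disjointness of the groups: no observation is used twice, so the family indexed by `S` inherits
  -- independence from `V`.
  have hinj : Function.Injective fun q : S => q.1.2 := by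
    rintro ⟨⟨k, j⟩, hq⟩ ⟨⟨k', j'⟩, hq'⟩ (rfl : j = j')
    simp only [S, Finset.mem_sigma, Finset.mem_univ, true_and] at hq hq'
    obtain rfl := eq_of_mem_Ico_castSucc_succ hc hq hq'
    rfl
  have hind : iIndepFun (S.restrict fun q ω => u q (V q.2 ω)) P :=
    (hindep.precomp hinj).comp (fun q => u q.1) fun q => hu q.1
  have huV : ∀ q : Σ _ : Fin K, ℕ, AEMeasurable (fun ω => u q (V q.2 ω)) P := fun q =>
    (hu q).comp_aemeasurable (hV q.2)
  have hprod := iIndepFun.charFun_map_fun_finsetSum_eq_prod (s := S)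
    (X := fun q ω => u q (V q.2 ω)) (fun q _ => huV q) hind
  calc charFun (P.map fun ω => groupSums c fun i => V i ω) t
      = charFun (P.map fun ω => ∑ q ∈ S, u q (V q.2 ω)) 1 := by
        rw [charFun_apply, charFun_apply_real, integral_map (aemeasurable_groupSums c hV)
          (by fun_prop), integral_map (Finset.aemeasurable_fun_sum _ fun q _ =>
            huV q) (by fun_prop)]
        simp_rw [hsum]
        simp
    _ = ∏ q ∈ S, charFun (P.map fun ω => ∑ l, t (q.1, l) * V 0 ω l) (a q.1) := by
        rw [hprod, Finset.prod_apply]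
        refine Finset.prod_congr rfl fun q _ => ?_
        have h1 : P.map (fun ω => u q (V q.2 ω)) = P.map (fun ω => u q (V 0 ω)) :=
          ((hident q.2).comp (hu q)).map_eq
        rw [h1, charFun_map_mul_comp (by
          refine Measurable.comp_aemeasurable (g := fun v : Fin L → ℝ => ∑ l, t (q.1, l) * v l)
            (by fun_prop) (hV 0)), mul_one]
    _ = _ := by
        simp [S, Finset.prod_sigma, ha]

/-- **Central limit theorem** for the normalized sums of standardized random vectors over
consecutive groups whose sizes tend to infinity. -/
theorem tendstoInDistribution_groupSums {Ω : Type*} [MeasurableSpace Ω] {P : Measure Ω}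
    [IsProbabilityMeasure P] {K L : ℕ} {c : ℕ → Fin (K + 1) → ℕ}
    (hc : ∀ᶠ n in atTop, Monotone (c n))
    (hsize : ∀ k : Fin K, Tendsto (fun n => c n k.succ - c n k.castSucc) atTop atTop)
    {V : ℕ → Ω → Fin L → ℝ} (hindep : iIndepFun V P) (hident : ∀ i, IdentDistrib (V i) (V 0) P P)
    (hL2 : ∀ l, MemLp (fun ω => V 0 ω l) 2 P) (hmean : ∀ l, ∫ ω, V 0 ω l ∂P = 0)
    (hcov : ∀ l l', ∫ ω, V 0 ω l * V 0 ω l' ∂P = if l = l' then 1 else 0) :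
    TendstoInDistribution (fun n ω => groupSums (c n) fun i => V i ω) atTop id (fun _ => P)
      (stdGaussian (EuclideanSpace ℝ (Fin K × Fin L))) where
  forall_aemeasurable n := aemeasurable_groupSums (c n) fun i => (hident i).aemeasurable_fst
  tendsto := by
    refine ProbabilityMeasure.tendsto_iff_tendsto_charFun.2 fun t => ?_
    simp only [ProbabilityMeasure.coe_mk, Measure.map_id, charFun_stdGaussian]
    have hmeas : ∀ k, Measurable fun v : Fin L → ℝ => ∑ l, t (k, l) * v l := fun k => by fun_prop
    have hlim : ∀ k, Tendsto (fun n => charFun (P.map fun ω => ∑ l, t (k, l) * V 0 ω l)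
        (√((c n k.succ - c n k.castSucc : ℕ) : ℝ))⁻¹ ^ (c n k.succ - c n k.castSucc)) atTop
        (nhds (Complex.exp (-(∑ l, t (k, l) ^ 2 : ℝ) / 2))) := fun k => by
      -- The scalar theorem for the combination given by row `k` of `t`, along the group sizes.
      -- Identity covariance makes its variance the squared norm of that row.
      have h := (tendsto_charFun_inv_sqrt_pow (Z := fun i ω => ∑ l, t (k, l) * V i ω l)
        (hindep.comp _ fun _ => hmeas k) (fun i => (hident i).comp (hmeas k))
        (memLp_finsetSum _ fun l _ => (hL2 l).const_mul _) ?_).comp (hsize k)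
      · suffices hvar : ∫ ω, (∑ l, t (k, l) * V 0 ω l) ^ 2 ∂P = ∑ l, t (k, l) ^ 2 by
          rw [hvar] at h
          exact h
        have hexp : ∀ ω, (∑ l, t (k, l) * V 0 ω l) ^ 2 =
            ∑ l, ∑ l', t (k, l) * t (k, l') * (V 0 ω l * V 0 ω l') := fun ω => by
          rw [sq, Finset.sum_mul_sum]
          exact Finset.sum_congr rfl fun l _ => Finset.sum_congr rfl fun l' _ => by ring
        have hint : ∀ l l', Integrable
            (fun ω => t (k, l) * t (k, l') * (V 0 ω l * V 0 ω l')) P := fun l l' =>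
          ((hL2 l).integrable_mul (hL2 l')).const_mul _
        rw [integral_congr_ae (Eventually.of_forall hexp)]
        rw [integral_finsetSum _ fun l _ => integrable_finsetSum _ fun l' _ => hint l l']
        refine Finset.sum_congr rfl fun l _ => ?_
        rw [integral_finsetSum _ fun l' _ => hint l l']
        simp [integral_const_mul, hcov, sq]
      · rw [integral_finsetSum _ fun l _ => ((hL2 l).integrable one_le_two).const_mul _]
        simp [integral_const_mul, hmean]
    have hprod := tendsto_finsetProd Finset.univ fun k _ => hlim k
    rw [← Complex.exp_sum, ← Finset.sum_div, Finset.sum_neg_distrib] at hprod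
    convert hprod.congr' ?_ using 4
    · rw [← Complex.ofReal_pow, EuclideanSpace.real_norm_sq_eq, Fintype.sum_prod_type,
        Complex.ofReal_sum]
    · filter_upwards [hc] with n hn
      exact (charFun_groupSums hn hindep hident t).symm

/-! ### Gaussian projections and the chi-square law -/

/-- The image of the standard Gaussian measure under an orthogonal projection is the standard
Gaussian measure of the subspace. -/
theorem map_orthogonalProjection_stdGaussian {E : Type*} [NormedAddCommGroup E]
    [InnerProductSpace ℝ E] [FiniteDimensional ℝ E] [MeasurableSpace E] [BorelSpace E]
    (V : Submodule ℝ E) :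
    (stdGaussian E).map V.orthogonalProjectionOnto = stdGaussian V := by
  have : IsProbabilityMeasure ((stdGaussian E).map V.orthogonalProjectionOnto) :=
    Measure.isProbabilityMeasure_map (by fun_prop)
  refine Measure.ext_of_charFun (funext fun t => ?_)
  rw [charFun_stdGaussian, charFun_apply, integral_map (by fun_prop) (by fun_prop)]
  have h := charFun_stdGaussian (t : E)
  rw [charFun_apply] at h
  simpa only [Submodule.inner_orthogonalProjectionOnto_eq_of_mem_right, Submodule.coe_norm] using h

/-- The squared norm of a standard Gaussian vector is chi-square distributed. -/
theorem map_norm_sq_stdGaussian (E : Type*) [NormedAddCommGroup E]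
    [InnerProductSpace ℝ E] [FiniteDimensional ℝ E] [MeasurableSpace E] [BorelSpace E] :
    (stdGaussian E).map (fun x => ‖x‖ ^ 2) = chiSquared (Module.finrank ℝ E) := by
  rw [stdGaussian, chiSquared, Measure.map_map (by fun_prop) (by fun_prop)]
  congr 1
  funext z
  have h := (stdOrthonormalBasis ℝ E).sum_repr_symm (WithLp.toLp 2 z)
  simp only at h
  rw [Function.comp_apply, h, LinearIsometryEquiv.norm_map, EuclideanSpace.real_norm_sq_eq]

/-- The matrices with `K` rows whose weighted column sums vanish. -/
def weightedColumnKernel {K L : ℕ} (p : Fin K → ℝ) :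
    Submodule ℝ (EuclideanSpace ℝ (Fin K × Fin L)) :=
  LinearMap.ker ({ toFun := fun x l => ∑ k, p k * x (k, l)
                   map_add' := fun x y => by
                     funext l; simp [mul_add, Finset.sum_add_distrib]
                   map_smul' := fun a x => by
                     funext l; simp [Finset.mul_sum, mul_left_comm] } :
    EuclideanSpace ℝ (Fin K × Fin L) →ₗ[ℝ] (Fin L → ℝ))

theorem mem_weightedColumnKernel {K L : ℕ} {p : Fin K → ℝ}
    {x : EuclideanSpace ℝ (Fin K × Fin L)} :
    x ∈ weightedColumnKernel p ↔ ∀ l, ∑ k, p k * x (k, l) = 0 := by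
  rw [weightedColumnKernel, LinearMap.mem_ker, funext_iff]
  rfl

/-- Rank-nullity: the weighted column sums map onto `ℝ^L`, because `p` is a unit vector and so the
array `p k * y l` is sent to `y`. -/
theorem finrank_weightedColumnKernel {K L : ℕ} {p : Fin K → ℝ} (hp : ∑ k, p k ^ 2 = 1) :
    Module.finrank ℝ (weightedColumnKernel (L := L) p) = (K - 1) * L := by
  have hsurj := LinearMap.finrank_range_add_finrank_ker
    ({ toFun := fun x l => ∑ k, p k * x (k, l)
       map_add' := fun x y => by funext l; simp [mul_add, Finset.sum_add_distrib]
       map_smul' := fun a x => by funext l; simp [Finset.mul_sum, mul_left_comm] } :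
      EuclideanSpace ℝ (Fin K × Fin L) →ₗ[ℝ] (Fin L → ℝ))
  rw [LinearMap.range_eq_top.2, finrank_top] at hsurj
  · simp only [Module.finrank_fintype_fun_eq_card, Fintype.card_fin, finrank_euclideanSpace,
      Fintype.card_prod] at hsurj
    change L + Module.finrank ℝ (weightedColumnKernel (L := L) p) = K * L at hsurj
    rw [Nat.sub_mul]
    omega
  · intro y
    refine ⟨WithLp.toLp 2 fun i => p i.1 * y i.2, ?_⟩
    funext l
    simp only [LinearMap.coe_mk, AddHom.coe_mk, ← mul_assoc, ← Finset.sum_mul, ← sq, hp, one_mul]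

/-- The residual has zero weighted column sums because `p` is a unit vector. What was removed is, in
each column, a multiple of `p`, hence orthogonal to the kernel. -/
theorem orthogonalProjection_weightedColumnKernel {K L : ℕ} {p : Fin K → ℝ}
    (hp : ∑ k, p k ^ 2 = 1) (x : EuclideanSpace ℝ (Fin K × Fin L)) :
    ((weightedColumnKernel (L := L) p).orthogonalProjectionOnto x :
      EuclideanSpace ℝ (Fin K × Fin L)) =
      WithLp.toLp 2 fun i => x i - p i.1 * ∑ j, p j * x (j, i.2) := by
  symm
  rw [← Submodule.starProjection_apply, eq_comm]
  refine Submodule.eq_starProjection_of_mem_of_inner_eq_zero ?_ ?_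
  · rw [mem_weightedColumnKernel]
    intro l
    simp only [mul_sub, Finset.sum_sub_distrib, ← mul_assoc, ← Finset.sum_mul, ← sq, hp, one_mul,
      sub_self]
  · intro w hw
    rw [mem_weightedColumnKernel] at hw
    simp only [PiLp.inner_apply, PiLp.sub_apply, sub_sub_cancel, RCLike.inner_apply, conj_trivial,
      Fintype.sum_prod_type]
    rw [Finset.sum_comm]
    refine Finset.sum_eq_zero fun l _ => ?_
    have h : ∑ k, w (k, l) * (p k * ∑ j, p j * x (j, l))
        = (∑ k, p k * w (k, l)) * ∑ j, p j * x (j, l) := by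
      rw [Finset.sum_mul]
      exact Finset.sum_congr rfl fun k _ => by ring
    rw [h, hw l, zero_mul]

/-- The residual sum of squares of a standard Gaussian array after removing from each column its
component along a unit vector is chi-square distributed. -/
theorem map_residual_stdGaussian {K L : ℕ} {p : Fin K → ℝ} (hp : ∑ k, p k ^ 2 = 1) :
    (stdGaussian (EuclideanSpace ℝ (Fin K × Fin L))).map
      (fun x => ∑ k, ∑ l, (x (k, l) - p k * ∑ j, p j * x (j, l)) ^ 2) =
      chiSquared ((K - 1) * L) := by
  have h := map_norm_sq_stdGaussian (weightedColumnKernel (L := L) p)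
  rw [finrank_weightedColumnKernel hp, ← map_orthogonalProjection_stdGaussian,
    Measure.map_map (by fun_prop) (by fun_prop)] at h
  rw [← h]
  congr 1
  funext x
  rw [Function.comp_apply, Submodule.coe_norm, orthogonalProjection_weightedColumnKernel hp,
    EuclideanSpace.real_norm_sq_eq, Fintype.sum_prod_type]

/-! ### Measurability of the statistic and continuity of inversion -/

theorem measurable_coordRank {L : ℕ} (n j : ℕ) (l : Fin L) :
    Measurable fun x : ℕ → Fin L → ℝ => coordRank n x j l := by
  unfold coordRank
  refine Finset.measurable_fun_sum _ fun k _ => ?_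
  exact Measurable.ite (measurableSet_le (by fun_prop) (by fun_prop)) measurable_const
    measurable_const

theorem measurable_centredRankMean {L : ℕ} (n a b : ℕ) (l : Fin L) :
    Measurable fun x : ℕ → Fin L → ℝ => centredRankMean n x a b l := by
  unfold centredRankMean
  exact (Measurable.const_mul (Finset.measurable_fun_sum _ fun j _ =>
    measurable_coordRank n j l) _).sub_const _

theorem measurable_rankCov {L : ℕ} (n : ℕ) (l l' : Fin L) :
    Measurable fun x : ℕ → Fin L → ℝ => rankCov n x l l' := by
  simp only [rankCov, Matrix.of_apply]
  exact Measurable.const_mul (Finset.measurable_fun_sum _ fun i _ =>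
    ((measurable_coordRank n i l).sub_const _).mul ((measurable_coordRank n i l').sub_const _)) _

/-- Inversion is discontinuous at singular matrices, but the formula adjugate over determinant holds
everywhere with the inverse of `0` read as `0`, and it is measurable. -/
theorem measurable_inv_matrix_apply {L : ℕ} (l l' : Fin L) :
    Measurable fun M : Fin L → Fin L → ℝ => (Matrix.of M)⁻¹ l l' := by
  have hof : Continuous fun M : Fin L → Fin L → ℝ => Matrix.of M := continuous_id
  have hdet : Measurable fun M : Fin L → Fin L → ℝ => (Matrix.of M).det :=
    (hof.matrix_det).measurable
  have hadj : Measurable fun M : Fin L → Fin L → ℝ => (Matrix.of M).adjugate l l' :=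
    ((hof.matrix_adjugate).matrix_elem l l').measurable
  simp only [Matrix.inv_def, Matrix.smul_apply, smul_eq_mul, Ring.inverse_eq_inv']
  exact hdet.inv.mul hadj

theorem measurable_inv_rankCov {L : ℕ} (n : ℕ) (l l' : Fin L) :
    Measurable fun x : ℕ → Fin L → ℝ => (rankCov n x)⁻¹ l l' :=
  (measurable_inv_matrix_apply l l').comp
    (measurable_pi_lambda _ fun a => measurable_pi_lambda _ fun b => measurable_rankCov n a b)

theorem measurable_kruskalWallis {L K : ℕ} (n : ℕ) (c : Fin (K + 1) → ℕ) :
    Measurable fun x : ℕ → Fin L → ℝ => kruskalWallis n c x := by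
  unfold kruskalWallis
  simp only [dotProduct, mulVec]
  refine Measurable.const_mul (Finset.measurable_fun_sum _ fun k _ => Measurable.const_mul
    (Finset.measurable_fun_sum _ fun l _ => (measurable_centredRankMean n _ _ l).mul
      (Finset.measurable_fun_sum _ fun l' _ => ?_)) _) _
  exact (measurable_inv_rankCov n l l').mul (measurable_centredRankMean n _ _ l')

theorem continuousAt_inv_matrix {L : ℕ} {M : Matrix (Fin L) (Fin L) ℝ} (hM : IsUnit M) :
    ContinuousAt (fun (N : Fin L → Fin L → ℝ) l l' => (Matrix.of N)⁻¹ l l')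
      (fun l l' => M l l') := by
  have hdet : M.det ≠ 0 := ((Matrix.isUnit_iff_isUnit_det M).1 hM).ne_zero
  refine continuousAt_matrix_inv M ?_
  rw [Ring.inverse_eq_inv']
  exact continuousAt_inv₀ hdet

/-! ### Decomposition of the rank means -/

/-- Sums over consecutive intervals add up to the sum over the whole interval. -/
theorem sum_sum_Ico_castSucc_succ {K : ℕ} {c : Fin (K + 1) → ℕ} (hc : Monotone c) (f : ℕ → ℝ) :
    ∑ k : Fin K, ∑ j ∈ Finset.Ico (c k.castSucc) (c k.succ), f j =
      ∑ j ∈ Finset.Ico (c 0) (c (Fin.last K)), f j := by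
  induction K with
  | zero => simp
  | succ K ih =>
    rw [Fin.sum_univ_castSucc]
    have h := ih (c := fun i => c i.castSucc) (hc.comp Fin.strictMono_castSucc.monotone)
    simp only [Fin.castSucc_zero] at h
    simp only [← Fin.succ_castSucc] at h ⊢
    rw [h, Fin.succ_last]
    exact Finset.sum_Ico_consecutive f (hc (Fin.zero_le _)) (hc (Fin.le_last _))

/-- The grades of an observation, centred by their common mean. -/
noncomputable def centredGrade {L : ℕ} (μ : Fin L → Measure ℝ) (v : Fin L → ℝ) : Fin L → ℝ :=
  fun l => cdf (μ l) (v l) - 1 / 2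

/-- The normalized degenerate part of the rank sums of the group of observations
`a, …, b - 1`. -/
noncomputable def degenerateRemainder {L : ℕ} (μ : Fin L → Measure ℝ) (n a b : ℕ)
    (x : ℕ → Fin L → ℝ) (l : Fin L) : ℝ :=
  (√((b - a : ℕ) : ℝ))⁻¹ * (n : ℝ)⁻¹ *
    ∑ j ∈ Finset.Ico a b, ∑ i ∈ Finset.range n, degenerateComparison (μ l) (x i l) (x j l)

/-- Hoeffding's decomposition of the comparison into its constant, its two one-variable projections
and the degenerate kernel, summed over the block. -/
theorem sum_coordRank_eq {L : ℕ} (μ : Fin L → Measure ℝ) (n a b : ℕ) (x : ℕ → Fin L → ℝ)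
    (l : Fin L) :
    ∑ j ∈ Finset.Ico a b, coordRank n x j l =
      (∑ j ∈ Finset.Ico a b, ∑ i ∈ Finset.range n, degenerateComparison (μ l) (x i l) (x j l)) +
      n * ∑ j ∈ Finset.Ico a b, centredGrade μ (x j) l -
      (b - a : ℕ) * ∑ i ∈ Finset.range n, centredGrade μ (x i) l + (b - a : ℕ) * (n / 2) := by
  have h : ∀ i j, (if x i l ≤ x j l then (1 : ℝ) else 0) =
      degenerateComparison (μ l) (x i l) (x j l) + centredGrade μ (x j) l -
        centredGrade μ (x i) l + 1 / 2 := fun i j => by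
    simp only [degenerateComparison, centredGrade]
    ring
  simp only [coordRank, h, Finset.sum_add_distrib, Finset.sum_sub_distrib, Finset.sum_const,
    Finset.card_range, Nat.card_Ico, nsmul_eq_mul, Finset.mul_sum]
  ring

/-- **Hájek decomposition** of the normalized rank means of consecutive groups. -/
theorem normalized_centredRankMean_eq {L K : ℕ} (μ : Fin L → Measure ℝ) {n : ℕ}
    {c : Fin (K + 1) → ℕ} (hc : StrictMono c) (hfirst : c 0 = 0) (hlast : c (Fin.last K) = n)
    (x : ℕ → Fin L → ℝ) (k : Fin K) (l : Fin L) :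
    √((c k.succ - c k.castSucc : ℕ) : ℝ) * (n : ℝ)⁻¹ *
        centredRankMean n x (c k.castSucc) (c k.succ) l =
      groupSums c (fun j => centredGrade μ (x j)) (k, l) -
        √((c k.succ - c k.castSucc : ℕ) / n) * ∑ j : Fin K, √((c j.succ - c j.castSucc : ℕ) / n) *
          groupSums c (fun j => centredGrade μ (x j)) (j, l) +
        degenerateRemainder μ n (c k.castSucc) (c k.succ) x l := by
  have hlt : ∀ j : Fin K, c j.castSucc < c j.succ := fun j => hc Fin.castSucc_lt_succ
  have hm : ∀ j : Fin K, 0 < ((c j.succ - c j.castSucc : ℕ) : ℝ) := fun j => by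
    exact_mod_cast Nat.sub_pos_of_lt (hlt j)
  have hn : 0 < (n : ℝ) := by
    have h1 : c k.succ ≤ c (Fin.last K) := hc.monotone (Fin.le_last _)
    exact_mod_cast (Nat.zero_le _).trans_lt ((hlt k).trans_le (hlast ▸ h1))
  -- Since `√(m_j / n) / √m_j = 1 / √n` for nonempty groups, the component along `p` is the
  -- normalized sum over all observations.
  have htotal : ∑ j : Fin K, √((c j.succ - c j.castSucc : ℕ) / n) *
      groupSums c (fun j => centredGrade μ (x j)) (j, l) =
      (√(n : ℝ))⁻¹ * ∑ i ∈ Finset.range n, centredGrade μ (x i) l := by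
    rw [Finset.range_eq_Ico]
    have h := sum_sum_Ico_castSucc_succ hc.monotone fun i => centredGrade μ (x i) l
    rw [hfirst, hlast] at h
    rw [← h, Finset.mul_sum]
    refine Finset.sum_congr rfl fun j _ => ?_
    have hs := (Real.sqrt_pos.2 (hm j)).ne'
    simp only [groupSums]
    rw [Real.sqrt_div (hm j).le]
    field_simp
  have hcast : ((c k.succ : ℕ) : ℝ) - (c k.castSucc : ℕ) = ((c k.succ - c k.castSucc : ℕ) : ℝ) := by
    rw [Nat.cast_sub (hlt k).le]
  rw [htotal]
  simp only [centredRankMean, degenerateRemainder, groupSums]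
  rw [hcast, sum_coordRank_eq μ, Real.sqrt_div (hm k).le]
  have hm' := hm k
  generalize ((c k.succ - c k.castSucc : ℕ) : ℝ) = m at hm' ⊢
  have hs := (Real.sqrt_pos.2 hm').ne'
  have hsn := (Real.sqrt_pos.2 hn).ne'
  have hsm : √m ^ 2 = m := Real.sq_sqrt hm'.le
  have hsn2 : √(n : ℝ) ^ 2 = n := Real.sq_sqrt hn.le
  -- In terms of `s = √m` and `r = √n` the identity becomes rational.
  generalize √m = s at *
  generalize √(n : ℝ) = r at *
  rw [← hsm, ← hsn2]
  field_simp
  ring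

/-- The statistic as a sum of quadratic forms in the normalized rank means. -/
theorem kruskalWallis_eq_sum {L K : ℕ} {n : ℕ} {c : Fin (K + 1) → ℕ} (hc : Monotone c)
    (x : ℕ → Fin L → ℝ) :
    kruskalWallis n c x = ∑ k : Fin K,
      (fun l => √((c k.succ - c k.castSucc : ℕ) : ℝ) * (n : ℝ)⁻¹ *
        centredRankMean n x (c k.castSucc) (c k.succ) l) ⬝ᵥ ((rankCov n x)⁻¹ *ᵥ
      fun l => √((c k.succ - c k.castSucc : ℕ) : ℝ) * (n : ℝ)⁻¹ *
        centredRankMean n x (c k.castSucc) (c k.succ) l) := by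
  rw [kruskalWallis, Finset.mul_sum]
  refine Finset.sum_congr rfl fun k _ => ?_
  have hle : c k.castSucc ≤ c k.succ := hc (Fin.castSucc_le_succ k)
  set R := centredRankMean n x (c k.castSucc) (c k.succ)
  have h : (fun l => √((c k.succ - c k.castSucc : ℕ) : ℝ) * (n : ℝ)⁻¹ * R l) =
      (√((c k.succ - c k.castSucc : ℕ) : ℝ) * (n : ℝ)⁻¹) • R := rfl
  rw [h, mulVec_smul, smul_dotProduct, dotProduct_smul, smul_eq_mul, smul_eq_mul, ← mul_assoc,
    ← mul_assoc, ← Nat.cast_sub hle, mul_mul_mul_comm, Real.mul_self_sqrt (Nat.cast_nonneg _)]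
  ring

/-! ### Negligibility of the degenerate remainder -/

theorem iIndepFun.eval {Ω : Type*} [MeasurableSpace Ω] {P : Measure Ω} {L : ℕ}
    {X : ℕ → Ω → Fin L → ℝ} (hindep : iIndepFun X P) (l : Fin L) :
    iIndepFun (fun i ω => X i ω l) P :=
  hindep.comp (fun _ v => v l) fun _ => measurable_pi_apply l

theorem map_eval_eq {Ω : Type*} [MeasurableSpace Ω] {P : Measure Ω} {L : ℕ}
    {X : ℕ → Ω → Fin L → ℝ} (hident : ∀ i, IdentDistrib (X i) (X 0) P P) (l : Fin L) (i : ℕ) :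
    P.map (fun ω => X i ω l) = P.map fun ω => X 0 ω l :=
  ((hident i).comp (measurable_pi_apply l)).map_eq

theorem aemeasurable_eval {Ω : Type*} [MeasurableSpace Ω] {P : Measure Ω} {L : ℕ}
    {X : ℕ → Ω → Fin L → ℝ} (hident : ∀ i, IdentDistrib (X i) (X 0) P P) (l : Fin L) (i : ℕ) :
    AEMeasurable (fun ω => X i ω l) P :=
  (measurable_pi_apply l).comp_aemeasurable (hident i).aemeasurable_fst

theorem aemeasurable_sequence {Ω : Type*} [MeasurableSpace Ω] {P : Measure Ω} {L : ℕ}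
    {X : ℕ → Ω → Fin L → ℝ} (hident : ∀ i, IdentDistrib (X i) (X 0) P P) :
    AEMeasurable (fun ω i => X i ω) P :=
  aemeasurable_pi_lambda _ fun i => (hident i).aemeasurable_fst

theorem measurable_degenerateRemainder {L : ℕ} (μ : Fin L → Measure ℝ) (n a b : ℕ) (l : Fin L) :
    Measurable fun x : ℕ → Fin L → ℝ => degenerateRemainder μ n a b x l := by
  unfold degenerateRemainder
  refine Measurable.const_mul (Finset.measurable_fun_sum _ fun j _ =>
    Finset.measurable_fun_sum _ fun i _ => ?_) _
  have hpair : Measurable fun x : ℕ → Fin L → ℝ => (x i l, x j l) := by fun_prop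
  exact (measurable_degenerateComparison (μ l)).comp hpair

/-- The squared normalization `1 / (m n²)` multiplies the second moment bound `12 m n`. Empty groups
and `n = 0` are covered by reading the inverse of `0` as `0`. -/
theorem integral_sq_degenerateRemainder_le {Ω : Type*} [MeasurableSpace Ω] {P : Measure Ω}
    [IsProbabilityMeasure P] {L : ℕ} {X : ℕ → Ω → Fin L → ℝ} (hindep : iIndepFun X P)
    (hident : ∀ i, IdentDistrib (X i) (X 0) P P)
    (hcont : ∀ l : Fin L, Continuous (cdf (P.map fun ω => X 0 ω l)))
    {n a b : ℕ} (hab : b - a ≤ n) (l : Fin L) :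
    ∫ ω, degenerateRemainder (fun l => P.map fun ω => X 0 ω l) n a b (fun i => X i ω) l ^ 2 ∂P ≤
      12 / n := by
  have h := integral_sq_sum_degenerateComparison_le (iIndepFun.eval hindep l)
    (aemeasurable_eval hident l) (map_eval_eq hident l) (hcont l) n (G := Finset.Ico a b)
    (by rwa [Nat.card_Ico])
  rw [Nat.card_Ico] at h
  simp only [degenerateRemainder, mul_pow, integral_const_mul, inv_pow,
    Real.sq_sqrt (Nat.cast_nonneg (b - a))]
  refine (mul_le_mul_of_nonneg_left h (by positivity)).trans ?_
  rcases Nat.eq_zero_or_pos n with rfl | hn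
  · simp
  rcases Nat.eq_zero_or_pos (b - a) with hm | hm
  · rw [hm, Nat.cast_zero, zero_mul, mul_zero, mul_zero]
    positivity
  · have hn' : (0 : ℝ) < n := by exact_mod_cast hn
    have hm' : (0 : ℝ) < (b - a : ℕ) := by exact_mod_cast hm
    generalize ((b - a : ℕ) : ℝ) = m at *
    refine le_of_eq ?_
    field_simp

theorem tendstoInMeasure_degenerateRemainder {Ω : Type*} [MeasurableSpace Ω] {P : Measure Ω}
    [IsProbabilityMeasure P] {L : ℕ} {X : ℕ → Ω → Fin L → ℝ} (hindep : iIndepFun X P)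
    (hident : ∀ i, IdentDistrib (X i) (X 0) P P)
    (hcont : ∀ l : Fin L, Continuous (cdf (P.map fun ω => X 0 ω l)))
    {a b : ℕ → ℕ} (hab : ∀ᶠ n in atTop, b n - a n ≤ n) (l : Fin L) :
    TendstoInMeasure P (fun n ω => degenerateRemainder (fun l => P.map fun ω => X 0 ω l) n (a n)
      (b n) (fun i => X i ω) l) atTop (fun _ => 0) := by
  refine tendstoInMeasure_zero_of_tendsto_integral_sq (Eventually.of_forall fun n => ?_) ?_
  · have hmeas : AEMeasurable (fun ω => degenerateRemainder (fun l => P.map fun ω => X 0 ω l) n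
        (a n) (b n) (fun i => X i ω) l) P :=
      Measurable.comp_aemeasurable (g := fun x : ℕ → Fin L → ℝ => degenerateRemainder
        (fun l => P.map fun ω => X 0 ω l) n (a n) (b n) x l)
        (measurable_degenerateRemainder _ n (a n) (b n) l) (aemeasurable_sequence hident)
    refine Integrable.of_bound
      (C := ((√((b n - a n : ℕ) : ℝ))⁻¹ * (n : ℝ)⁻¹ * ((b n - a n : ℕ) * (n * 2))) ^ 2)
      (hmeas.pow_const 2).aestronglyMeasurable
      (Eventually.of_forall fun ω => ?_)
    rw [norm_pow]
    gcongr
    rw [degenerateRemainder, norm_mul, Real.norm_of_nonneg (by positivity)]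
    gcongr
    refine (norm_sum_le_of_le _ fun j _ => norm_sum_le_of_le _ fun i _ =>
      abs_degenerateComparison_le _ _ _).trans ?_
    simp
  · refine tendsto_of_tendsto_of_tendsto_of_le_of_le' tendsto_const_nhds
      (tendsto_const_div_atTop_nhds_zero_nat 12)
      (Eventually.of_forall fun n => integral_nonneg fun ω => sq_nonneg _) ?_
    filter_upwards [hab] with n hn
    exact integral_sq_degenerateRemainder_le hindep hident hcont hn l

/-! ### Consistency of the rank covariance -/

theorem abs_centredGrade_le {L : ℕ} (μ : Fin L → Measure ℝ) (v : Fin L → ℝ) (l : Fin L) :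
    |centredGrade μ v l| ≤ 1 := by
  rw [centredGrade, abs_le]
  have h0 := cdf_nonneg (μ l) (v l)
  have h1 := cdf_le_one (μ l) (v l)
  constructor <;> linarith

theorem measurable_centredGrade {L : ℕ} (μ : Fin L → Measure ℝ) : Measurable (centredGrade μ) :=
  measurable_pi_lambda _ fun l =>
    ((measurable_cdf (μ l)).comp (measurable_pi_apply l)).sub_const _

theorem coordRank_div_sub_centredGrade {L : ℕ} (μ : Fin L → Measure ℝ) {n : ℕ} (hn : 0 < n)
    (x : ℕ → Fin L → ℝ) (i : ℕ) (l : Fin L) :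
    coordRank n x i l / n - 1 / 2 - centredGrade μ (x i) l =
      (n : ℝ)⁻¹ * ∑ k ∈ Finset.range n, comparisonGap (μ l) (x k l) (x i l) := by
  have hn' : (n : ℝ) ≠ 0 := by exact_mod_cast hn.ne'
  simp only [comparisonGap, Finset.sum_sub_distrib, Finset.sum_const, Finset.card_range,
    nsmul_eq_mul, coordRank, centredGrade]
  field_simp
  ring

theorem abs_coordRank_div_sub_le {L : ℕ} (n : ℕ) (x : ℕ → Fin L → ℝ) (i : ℕ) (l : Fin L) :
    |coordRank n x i l / n - 1 / 2| ≤ 1 := by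
  have h0 : 0 ≤ coordRank n x i l := Finset.sum_nonneg fun k _ => by split_ifs <;> norm_num
  have h1 : coordRank n x i l ≤ n := by
    refine (Finset.sum_le_sum (g := fun _ => (1 : ℝ)) fun k _ => ?_).trans (by simp)
    split_ifs <;> norm_num
  have h2 : coordRank n x i l / n ≤ 1 := div_le_one_of_le₀ h1 (Nat.cast_nonneg n)
  have h3 : 0 ≤ coordRank n x i l / n := by positivity
  rw [abs_le]
  constructor <;> linarith

theorem rankCov_apply_eq {L : ℕ} {n : ℕ} (hn : 0 < n) (x : ℕ → Fin L → ℝ) (l l' : Fin L) :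
    rankCov n x l l' = (∑ i ∈ Finset.range n,
      (coordRank n x i l / n - 1 / 2) * (coordRank n x i l' / n - 1 / 2)) / n := by
  have hn' : (n : ℝ) ≠ 0 := by exact_mod_cast hn.ne'
  rw [rankCov, Matrix.of_apply, Finset.mul_sum, Finset.sum_div]
  refine Finset.sum_congr rfl fun i _ => ?_
  field_simp

/-- The empirical rank covariances are close to the empirical covariances of the grades. -/
theorem sq_rankCov_sub_le {L : ℕ} (μ : Fin L → Measure ℝ) {n : ℕ} (hn : 0 < n)
    (x : ℕ → Fin L → ℝ) (l l' : Fin L) :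
    (rankCov n x l l' -
        (∑ i ∈ Finset.range n, centredGrade μ (x i) l * centredGrade μ (x i) l') / n) ^ 2 ≤
      2 / n ^ 3 * ∑ i ∈ Finset.range n,
        ((∑ k ∈ Finset.range n, comparisonGap (μ l) (x k l) (x i l)) ^ 2 +
          (∑ k ∈ Finset.range n, comparisonGap (μ l') (x k l') (x i l')) ^ 2) := by
  have hn' : (0 : ℝ) < n := by exact_mod_cast hn
  rw [rankCov_apply_eq hn, ← sub_div, ← Finset.sum_sub_distrib, div_pow]
  -- Cauchy–Schwarz moves the square inside the sum. Each difference of products is then split into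
  -- two errors, each multiplied by a factor of modulus at most `1`.
  have hcs := sq_sum_le_card_mul_sum_sq (s := Finset.range n) (f := fun i =>
    (coordRank n x i l / n - 1 / 2) * (coordRank n x i l' / n - 1 / 2) -
      centredGrade μ (x i) l * centredGrade μ (x i) l')
  rw [Finset.card_range] at hcs
  have hterm : ∀ i, ((coordRank n x i l / n - 1 / 2) * (coordRank n x i l' / n - 1 / 2) -
      centredGrade μ (x i) l * centredGrade μ (x i) l') ^ 2 ≤ 2 / n ^ 2 *
        ((∑ k ∈ Finset.range n, comparisonGap (μ l) (x k l) (x i l)) ^ 2 +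
          (∑ k ∈ Finset.range n, comparisonGap (μ l') (x k l') (x i l')) ^ 2) := fun i => by
    have he := coordRank_div_sub_centredGrade μ hn x i l
    have he' := coordRank_div_sub_centredGrade μ hn x i l'
    have ha := abs_coordRank_div_sub_le n x i l'
    have hu := abs_centredGrade_le μ (x i) l
    generalize coordRank n x i l / n - 1 / 2 = A at *
    generalize coordRank n x i l' / n - 1 / 2 = A' at *
    generalize centredGrade μ (x i) l = u at *
    generalize centredGrade μ (x i) l' = u' at *
    generalize ∑ k ∈ Finset.range n, comparisonGap (μ l) (x k l) (x i l) = s at *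
    generalize ∑ k ∈ Finset.range n, comparisonGap (μ l') (x k l') (x i l') = s' at *
    have h1 : A * A' - u * u' = (A - u) * A' + u * (A' - u') := by ring
    have h2 : A' ^ 2 ≤ 1 := (sq_le_one_iff_abs_le_one _).2 ha
    have h3 : u ^ 2 ≤ 1 := (sq_le_one_iff_abs_le_one _).2 hu
    calc (A * A' - u * u') ^ 2 = ((A - u) * A' + u * (A' - u')) ^ 2 := by rw [h1]
      _ ≤ 2 * (((A - u) * A') ^ 2 + (u * (A' - u')) ^ 2) := add_sq_le
      _ ≤ 2 * ((A - u) ^ 2 + (A' - u') ^ 2) := by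
          rw [mul_pow, mul_pow]
          gcongr
          · exact mul_le_of_le_one_right (sq_nonneg _) h2
          · exact mul_le_of_le_one_left (sq_nonneg _) h3
      _ = 2 / n ^ 2 * (s ^ 2 + s' ^ 2) := by
          rw [he, he']
          field_simp
  calc _ ≤ ((n : ℝ) * ∑ i ∈ Finset.range n, 2 / (n : ℝ) ^ 2 *
        ((∑ k ∈ Finset.range n, comparisonGap (μ l) (x k l) (x i l)) ^ 2 +
          (∑ k ∈ Finset.range n, comparisonGap (μ l') (x k l') (x i l')) ^ 2)) / n ^ 2 := by
        gcongr
        exact hcs.trans (mul_le_mul_of_nonneg_left (Finset.sum_le_sum fun i _ => hterm i) hn'.le)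
    _ = _ := by
        rw [← Finset.mul_sum]
        field_simp

theorem integral_centredGrade {Ω : Type*} [MeasurableSpace Ω] {P : Measure Ω}
    [IsProbabilityMeasure P] {L : ℕ} {Y : Ω → Fin L → ℝ} (hY : AEMeasurable Y P)
    (hcont : ∀ l : Fin L, Continuous (cdf (P.map fun ω => Y ω l))) (l : Fin L) :
    ∫ ω, centredGrade (fun l => P.map fun ω => Y ω l) (Y ω) l ∂P = 0 := by
  have hYl : AEMeasurable (fun ω => Y ω l) P := (measurable_pi_apply l).comp_aemeasurable hY
  have := Measure.isProbabilityMeasure_map hYl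
  have h := integral_cdf (hcont l)
  rw [integral_map hYl (measurable_cdf _).aestronglyMeasurable] at h
  simp only [centredGrade]
  rw [integral_sub _ (integrable_const _), h]
  · simp
  · exact (integrable_cdf _ _).comp_aemeasurable hYl

/-- Each grade has mean `1 / 2`, so the centring in the covariance is that of `centredGrade`. -/
theorem gradeCov_apply {Ω : Type*} [MeasurableSpace Ω] {P : Measure Ω}
    [IsProbabilityMeasure P] {L : ℕ} {Y : Ω → Fin L → ℝ} (hY : AEMeasurable Y P)
    (hcont : ∀ l : Fin L, Continuous (cdf (P.map fun ω => Y ω l))) (l l' : Fin L) :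
    gradeCov P Y l l' = ∫ ω, centredGrade (fun l => P.map fun ω => Y ω l) (Y ω) l *
      centredGrade (fun l => P.map fun ω => Y ω l) (Y ω) l' ∂P := by
  have hmean : ∀ l, ∫ ω, cdf (P.map fun ω => Y ω l) (Y ω l) ∂P = 1 / 2 := fun l => by
    have hYl : AEMeasurable (fun ω => Y ω l) P := (measurable_pi_apply l).comp_aemeasurable hY
    have := Measure.isProbabilityMeasure_map hYl
    have h := integral_cdf (hcont l)
    rwa [integral_map hYl (measurable_cdf _).aestronglyMeasurable] at h
  simp only [gradeCov, Matrix.of_apply, covariance, hmean, centredGrade]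

theorem integrable_centredGrade_mul {Ω : Type*} [MeasurableSpace Ω] {P : Measure Ω}
    [IsProbabilityMeasure P] {L : ℕ} {Y : Ω → Fin L → ℝ} (hY : AEMeasurable Y P)
    (μ : Fin L → Measure ℝ) (l l' : Fin L) :
    Integrable (fun ω => centredGrade μ (Y ω) l * centredGrade μ (Y ω) l') P := by
  have hm : ∀ l, AEMeasurable (fun ω => centredGrade μ (Y ω) l) P := fun l =>
    ((measurable_pi_apply l).comp (measurable_centredGrade μ)).comp_aemeasurable hY
  refine Integrable.of_bound (C := 1) ((hm l).mul (hm l')).aestronglyMeasurable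
    (Eventually.of_forall fun ω => ?_)
  rw [Real.norm_eq_abs, abs_mul]
  exact mul_le_one₀ (abs_centredGrade_le μ _ l) (abs_nonneg _) (abs_centredGrade_le μ _ l')

/-- The empirical rank covariances are consistent. -/
theorem tendstoInMeasure_rankCov {Ω : Type*} [MeasurableSpace Ω] {P : Measure Ω}
    [IsProbabilityMeasure P] {L : ℕ} {X : ℕ → Ω → Fin L → ℝ} (hindep : iIndepFun X P)
    (hident : ∀ i, IdentDistrib (X i) (X 0) P P)
    (hcont : ∀ l : Fin L, Continuous (cdf (P.map fun ω => X 0 ω l))) (l l' : Fin L) :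
    TendstoInMeasure P (fun n ω => rankCov n (fun i => X i ω) l l') atTop
      (fun _ => gradeCov P (X 0) l l') := by
  set μ : Fin L → Measure ℝ := fun l => P.map fun ω => X 0 ω l
  have hX := fun i => (hident i).aemeasurable_fst
  have hprod : Measurable fun v : Fin L → ℝ => centredGrade μ v l * centredGrade μ v l' :=
    ((measurable_pi_apply l).comp (measurable_centredGrade μ)).mul
      ((measurable_pi_apply l').comp (measurable_centredGrade μ))
  have hslln := strong_law_ae_real
    (fun i ω => centredGrade μ (X i ω) l * centredGrade μ (X i ω) l')
    (integrable_centredGrade_mul (hX 0) μ l l')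
    (fun i j hij => (hindep.indepFun hij).comp hprod hprod)
    (fun i => (hident i).comp hprod)
  have hmeas : ∀ n : ℕ, AEMeasurable (fun ω => (∑ i ∈ Finset.range n,
      centredGrade μ (X i ω) l * centredGrade μ (X i ω) l') / (n : ℝ)) P := fun n =>
    (Finset.aemeasurable_fun_sum _ fun i _ => hprod.comp_aemeasurable (hX i)).div_const _
  have havg := tendstoInMeasure_of_tendsto_ae (fun n => (hmeas n).aestronglyMeasurable) hslln
  have hgap : ∀ (n i : ℕ) (l : Fin L), AEMeasurable (fun ω => ∑ k ∈ Finset.range n,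
      comparisonGap (μ l) (X k ω l) (X i ω l)) P := fun n i l =>
    Finset.aemeasurable_fun_sum _ fun k _ => (measurable_comparisonGap (μ l)).comp_aemeasurable
      ((aemeasurable_eval hident l k).prodMk (aemeasurable_eval hident l i))
  have hgapint : ∀ (n i : ℕ) (l : Fin L), Integrable (fun ω => (∑ k ∈ Finset.range n,
      comparisonGap (μ l) (X k ω l) (X i ω l)) ^ 2) P := fun n i l => by
    refine Integrable.of_bound (C := (n : ℝ) ^ 2) ((hgap n i l).pow_const 2).aestronglyMeasurable
      (Eventually.of_forall fun ω => ?_)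
    rw [norm_pow]
    gcongr
    refine (norm_sum_le_of_le _ fun k _ => abs_comparisonGap_le _ _ _).trans ?_
    simp
  have hdiff : TendstoInMeasure P (fun n ω => rankCov n (fun i => X i ω) l l' -
      (∑ i ∈ Finset.range n, centredGrade μ (X i ω) l * centredGrade μ (X i ω) l') / (n : ℝ))
      atTop (fun _ => 0) := by
    have hbound : ∀ n : ℕ, Integrable (fun ω => 2 / (n : ℝ) ^ 3 * ∑ i ∈ Finset.range n,
        ((∑ k ∈ Finset.range n, comparisonGap (μ l) (X k ω l) (X i ω l)) ^ 2 +
          (∑ k ∈ Finset.range n, comparisonGap (μ l') (X k ω l') (X i ω l')) ^ 2)) P := fun n =>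
      (integrable_finsetSum _ fun i _ => (hgapint n i l).add (hgapint n i l')).const_mul _
    have hintd : ∀ᶠ n : ℕ in atTop, Integrable (fun ω => (rankCov n (fun i => X i ω) l l' -
        (∑ i ∈ Finset.range n, centredGrade μ (X i ω) l * centredGrade μ (X i ω) l') /
          (n : ℝ)) ^ 2) P := by
      filter_upwards [eventually_gt_atTop 0] with n hn
      refine (hbound n).mono' ((((measurable_rankCov n l l').comp_aemeasurable
        (aemeasurable_sequence hident)).sub (hmeas n)).pow_const 2).aestronglyMeasurable
        (Eventually.of_forall fun ω => ?_)
      rw [Real.norm_of_nonneg (sq_nonneg _)]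
      exact sq_rankCov_sub_le μ hn _ l l'
    refine tendstoInMeasure_zero_of_tendsto_integral_sq hintd ?_
    refine tendsto_of_tendsto_of_tendsto_of_le_of_le' tendsto_const_nhds
      -- The bound is `2 / n ^ 3` times `n` terms of size `4 n`, the latter being `2 n` from each of
      -- the two coordinates.
      (tendsto_const_div_atTop_nhds_zero_nat 8)
      (Eventually.of_forall fun n => integral_nonneg fun ω => sq_nonneg _) ?_
    filter_upwards [eventually_gt_atTop 0, hintd] with n hn hi
    have hn' : (0 : ℝ) < n := by exact_mod_cast hn
    refine (integral_mono hi (hbound n) fun ω => sq_rankCov_sub_le μ hn _ l l').trans ?_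
    have hadd : ∀ i, Integrable (fun ω =>
        (∑ k ∈ Finset.range n, comparisonGap (μ l) (X k ω l) (X i ω l)) ^ 2 +
          (∑ k ∈ Finset.range n, comparisonGap (μ l') (X k ω l') (X i ω l')) ^ 2) P := fun i =>
      (hgapint n i l).add (hgapint n i l')
    rw [integral_const_mul, integral_finsetSum _ fun i _ => hadd i]
    have hle : ∑ i ∈ Finset.range n, ∫ ω,
        ((∑ k ∈ Finset.range n, comparisonGap (μ l) (X k ω l) (X i ω l)) ^ 2 +
          (∑ k ∈ Finset.range n, comparisonGap (μ l') (X k ω l') (X i ω l')) ^ 2) ∂P ≤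
        ∑ _i ∈ Finset.range n, (4 * n : ℝ) := Finset.sum_le_sum fun i _ => by
      rw [integral_add (hgapint n i l) (hgapint n i l')]
      have h1 := integral_sq_sum_comparisonGap_le (iIndepFun.eval hindep l)
        (aemeasurable_eval hident l) (map_eval_eq hident l) n i
      have h2 := integral_sq_sum_comparisonGap_le (iIndepFun.eval hindep l')
        (aemeasurable_eval hident l') (map_eval_eq hident l') n i
      linarith
    refine (mul_le_mul_of_nonneg_left hle (by positivity)).trans (le_of_eq ?_)
    rw [Finset.sum_const, Finset.card_range, nsmul_eq_mul]
    field_simp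
    norm_num
  have hsum := TendstoInMeasure.add_const hdiff havg
  rw [gradeCov_apply (hX 0) hcont]
  simpa only [sub_add_cancel, zero_add] using hsum

/-! ### Standardization of the grades -/

open scoped MatrixOrder in
-- The positive square root is symmetric, so it serves as `B`.
theorem Matrix.PosSemidef.exists_eq_mul_transpose {L : ℕ} {S : Matrix (Fin L) (Fin L) ℝ}
    (hS : S.PosSemidef) : ∃ B : Matrix (Fin L) (Fin L) ℝ, B * Bᵀ = S := by
  refine ⟨CFC.sqrt S, ?_⟩
  have h : (CFC.sqrt S)ᴴ = CFC.sqrt S := (CFC.sqrt_nonneg S).isSelfAdjoint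
  rw [Matrix.conjTranspose_eq_transpose_of_trivial] at h
  rw [h, CFC.sqrt_mul_sqrt_self S hS.nonneg]

/-- The quadratic form at `x` is the second moment of the combination of centred grades with
coefficients `x`. -/
theorem posSemidef_gradeCov {Ω : Type*} [MeasurableSpace Ω] {P : Measure Ω}
    [IsProbabilityMeasure P] {L : ℕ} {Y : Ω → Fin L → ℝ} (hY : AEMeasurable Y P)
    (hcont : ∀ l : Fin L, Continuous (cdf (P.map fun ω => Y ω l))) :
    (gradeCov P Y).PosSemidef := by
  refine Matrix.PosSemidef.of_dotProduct_mulVec_nonneg ?_ fun x => ?_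
  · ext l l'
    simp only [Matrix.conjTranspose_apply, star_trivial, gradeCov_apply hY hcont, mul_comm]
  · have h : star x ⬝ᵥ gradeCov P Y *ᵥ x = ∫ ω,
        (∑ l, x l * centredGrade (fun l => P.map fun ω => Y ω l) (Y ω) l) ^ 2 ∂P := by
      have hint := fun l l' => (integrable_centredGrade_mul hY
        (fun l => P.map fun ω => Y ω l) l l').const_mul (x l * x l')
      have hexp : ∀ ω, (∑ l, x l * centredGrade (fun l => P.map fun ω => Y ω l) (Y ω) l) ^ 2 =
          ∑ l, ∑ l', x l * x l' * (centredGrade (fun l => P.map fun ω => Y ω l) (Y ω) l *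
            centredGrade (fun l => P.map fun ω => Y ω l) (Y ω) l') := fun ω => by
        rw [sq, Finset.sum_mul_sum]
        exact Finset.sum_congr rfl fun l _ => Finset.sum_congr rfl fun l' _ => by ring
      rw [integral_congr_ae (Eventually.of_forall hexp),
        integral_finsetSum _ fun l _ => integrable_finsetSum _ fun l' _ => hint l l']
      simp only [dotProduct, mulVec, Pi.star_apply, star_trivial]
      refine Finset.sum_congr rfl fun l _ => ?_
      rw [integral_finsetSum _ fun l' _ => hint l l', Finset.mul_sum]
      refine Finset.sum_congr rfl fun l' _ => ?_
      rw [integral_const_mul, gradeCov_apply hY hcont]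
      ring
    rw [h]
    exact integral_nonneg fun ω => sq_nonneg _

/-- Standardizing the grades by a square root of their covariance matrix. -/
theorem integral_standardized_mul {Ω : Type*} [MeasurableSpace Ω] {P : Measure Ω}
    [IsProbabilityMeasure P] {L : ℕ} {Y : Ω → Fin L → ℝ} (hY : AEMeasurable Y P)
    (hcont : ∀ l : Fin L, Continuous (cdf (P.map fun ω => Y ω l)))
    {B : Matrix (Fin L) (Fin L) ℝ} (hB : B * Bᵀ = gradeCov P Y) (hunit : IsUnit B) (l l' : Fin L) :
    ∫ ω, (B⁻¹ *ᵥ centredGrade (fun l => P.map fun ω => Y ω l) (Y ω)) l *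
      (B⁻¹ *ᵥ centredGrade (fun l => P.map fun ω => Y ω l) (Y ω)) l' ∂P =
      if l = l' then 1 else 0 := by
  have hdet := (Matrix.isUnit_iff_isUnit_det B).1 hunit
  have hone : B⁻¹ * gradeCov P Y * B⁻¹ᵀ = 1 := by
    rw [← hB, ← mul_assoc, Matrix.nonsing_inv_mul B hdet, one_mul, ← Matrix.transpose_mul,
      Matrix.nonsing_inv_mul B hdet, Matrix.transpose_one]
  have hint := fun a b => (integrable_centredGrade_mul hY
    (fun l => P.map fun ω => Y ω l) a b).const_mul (B⁻¹ l a * B⁻¹ l' b)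
  have hexp : ∀ ω, (B⁻¹ *ᵥ centredGrade (fun l => P.map fun ω => Y ω l) (Y ω)) l *
      (B⁻¹ *ᵥ centredGrade (fun l => P.map fun ω => Y ω l) (Y ω)) l' =
      ∑ a, ∑ b, B⁻¹ l a * B⁻¹ l' b * (centredGrade (fun l => P.map fun ω => Y ω l) (Y ω) a *
        centredGrade (fun l => P.map fun ω => Y ω l) (Y ω) b) := fun ω => by
    simp only [mulVec, dotProduct]
    rw [Finset.sum_mul_sum]
    exact Finset.sum_congr rfl fun a _ => Finset.sum_congr rfl fun b _ => by ring
  rw [integral_congr_ae (Eventually.of_forall hexp),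
    integral_finsetSum _ fun a _ => integrable_finsetSum _ fun b _ => hint a b,
    ← Matrix.one_apply, ← hone, Matrix.mul_apply]
  simp only [Matrix.mul_apply, Finset.sum_mul, Matrix.transpose_apply]
  rw [Finset.sum_comm]
  refine Finset.sum_congr rfl fun a _ => ?_
  rw [integral_finsetSum _ fun b _ => hint a b]
  refine Finset.sum_congr rfl fun b _ => ?_
  rw [integral_const_mul, gradeCov_apply hY hcont]
  ring

theorem groupSums_mulVec {K L : ℕ} (c : Fin (K + 1) → ℕ) (B : Matrix (Fin L) (Fin L) ℝ)
    (v : ℕ → Fin L → ℝ) (k : Fin K) (l : Fin L) :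
    groupSums c (fun j => B *ᵥ v j) (k, l) = ∑ l', B l l' * groupSums c v (k, l') := by
  simp only [groupSums, mulVec, dotProduct, Finset.mul_sum]
  rw [Finset.sum_comm]
  exact Finset.sum_congr rfl fun l' _ => Finset.sum_congr rfl fun j _ => by ring

/-! ### The limiting quadratic form -/

/-- The residuals of an array after removing from each column its component along `p`. -/
def arrayResidual {K L : ℕ} (p : Fin K → ℝ) (w : EuclideanSpace ℝ (Fin K × Fin L)) (k : Fin K) :
    Fin L → ℝ :=
  fun l => w (k, l) - p k * ∑ j, p j * w (j, l)

/-- The sum of the quadratic forms with matrix `M` in the rows of a linearly transformed residual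
array, shifted by `d`. -/
def residualForm {K L : ℕ} (B : Matrix (Fin L) (Fin L) ℝ)
    (z : EuclideanSpace ℝ (Fin K × Fin L) ×
      (Fin K → Fin L → ℝ) × (Fin K → ℝ) × (Fin L → Fin L → ℝ)) : ℝ :=
  ∑ k, (B *ᵥ arrayResidual z.2.2.1 z.1 k + z.2.1 k) ⬝ᵥ
    (Matrix.of z.2.2.2 *ᵥ (B *ᵥ arrayResidual z.2.2.1 z.1 k + z.2.1 k))

/-- The inverse covariance is an argument of its own, so the form is polynomial in all its arguments
and the discontinuity of inversion plays no role here. -/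
theorem continuous_residualForm {K L : ℕ} (B : Matrix (Fin L) (Fin L) ℝ) :
    Continuous (residualForm (K := K) B) := by
  unfold residualForm arrayResidual
  simp only [dotProduct, mulVec, Matrix.of_apply, Pi.add_apply]
  fun_prop

/-- Since `Bᵀ S⁻¹ B = 1`, the form at `B r` is the squared norm of `r`. -/
theorem residualForm_zero_inv {K L : ℕ} {B S : Matrix (Fin L) (Fin L) ℝ} (hB : B * Bᵀ = S)
    (hunit : IsUnit B) (w : EuclideanSpace ℝ (Fin K × Fin L)) (p : Fin K → ℝ) :
    residualForm B (w, 0, p, fun l l' => S⁻¹ l l') =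
      ∑ k, ∑ l, (w (k, l) - p k * ∑ j, p j * w (j, l)) ^ 2 := by
  have hdet := (Matrix.isUnit_iff_isUnit_det B).1 hunit
  have hone : Bᵀ * S⁻¹ * B = 1 := by
    rw [← hB, Matrix.mul_inv_rev, ← mul_assoc, ← Matrix.transpose_nonsing_inv,
      ← Matrix.transpose_mul, Matrix.nonsing_inv_mul B hdet, Matrix.transpose_one, one_mul,
      Matrix.nonsing_inv_mul B hdet]
  refine Finset.sum_congr rfl fun k _ => ?_
  change (B *ᵥ arrayResidual p w k + 0) ⬝ᵥ (S⁻¹ *ᵥ (B *ᵥ arrayResidual p w k + 0)) = _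
  rw [add_zero, Matrix.dotProduct_mulVec, Matrix.dotProduct_mulVec, ← Matrix.vecMul_transpose,
    Matrix.vecMul_vecMul, Matrix.vecMul_vecMul, ← mul_assoc, hone, Matrix.vecMul_one]
  simp only [dotProduct, arrayResidual, sq]

/-! ### Group proportions and the limit theorem -/

/-- Only the law of the limit matters for convergence in distribution. -/
theorem TendstoInDistribution.of_map_eq {Ω Ω' : Type*} [MeasurableSpace Ω] [MeasurableSpace Ω']
    {P : Measure Ω} {P' : Measure Ω'} [IsProbabilityMeasure P] [IsProbabilityMeasure P']
    {Q : Measure ℝ} [IsProbabilityMeasure Q] {Y : ℕ → Ω → ℝ} {W : Ω' → ℝ}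
    (h : TendstoInDistribution Y atTop W (fun _ => P) P') (hW : P'.map W = Q) :
    TendstoInDistribution Y atTop (id : ℝ → ℝ) (fun _ => P) Q where
  forall_aemeasurable := h.forall_aemeasurable
  tendsto := by
    have hlim := h.tendsto
    have heq : (⟨P'.map W, Measure.isProbabilityMeasure_map h.aemeasurable_limit⟩ :
        ProbabilityMeasure ℝ) = ⟨Q.map id, Measure.isProbabilityMeasure_map aemeasurable_id⟩ :=
      Subtype.ext (hW.trans Measure.map_id.symm)
    rwa [heq] at hlim

/-- A positive limit proportion forces a positive group size for large `n`. All later uses of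
nonempty, ordered groups rest on this. -/
theorem eventually_strictMono {K : ℕ} {c : ℕ → Fin (K + 1) → ℕ} {lam : Fin K → ℝ}
    (hlam : ∀ k, 0 < lam k)
    (hlim : ∀ k : Fin K,
      Tendsto (fun n => ((c n k.succ : ℝ) - c n k.castSucc) / n) atTop (nhds (lam k))) :
    ∀ᶠ n in atTop, StrictMono (c n) := by
  have h : ∀ᶠ n in atTop, ∀ k : Fin K, 0 < ((c n k.succ : ℝ) - c n k.castSucc) / n :=
    eventually_all.2 fun k => (hlim k).eventually_const_lt (hlam k)
  filter_upwards [h, eventually_gt_atTop 0] with n hn hpos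
  refine Fin.strictMono_iff_lt_succ.2 fun k => ?_
  have hpos' : (0 : ℝ) < n := by exact_mod_cast hpos
  have h1 := (div_pos_iff_of_pos_right hpos').1 (hn k)
  exact_mod_cast sub_pos.1 h1

theorem tendsto_groupSize_div {K : ℕ} {c : ℕ → Fin (K + 1) → ℕ} {lam : Fin K → ℝ}
    (hmono : ∀ᶠ n in atTop, StrictMono (c n))
    (hlim : ∀ k : Fin K,
      Tendsto (fun n => ((c n k.succ : ℝ) - c n k.castSucc) / n) atTop (nhds (lam k)))
    (k : Fin K) :
    Tendsto (fun n => ((c n k.succ - c n k.castSucc : ℕ) : ℝ) / n) atTop (nhds (lam k)) := by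
  refine (hlim k).congr' ?_
  filter_upwards [hmono] with n hn
  rw [Nat.cast_sub (hn.monotone (Fin.castSucc_le_succ k))]

theorem tendsto_groupSize {K : ℕ} {c : ℕ → Fin (K + 1) → ℕ} {lam : Fin K → ℝ}
    (hlam : ∀ k, 0 < lam k) {k : Fin K}
    (hlim : Tendsto (fun n => ((c n k.succ - c n k.castSucc : ℕ) : ℝ) / n) atTop
      (nhds (lam k))) :
    Tendsto (fun n => c n k.succ - c n k.castSucc) atTop atTop := by
  rw [← tendsto_natCast_atTop_iff (R := ℝ)]
  refine (hlim.pos_mul_atTop (hlam k) tendsto_natCast_atTop_atTop).congr' ?_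
  filter_upwards [eventually_gt_atTop 0] with n hn
  exact div_mul_cancel₀ _ (by exact_mod_cast hn.ne')

/-- The group sizes telescope to `n`, so the proportions sum to `1` before the limit. This makes
`√λ` a unit vector, as the projection requires. -/
theorem sum_lam_eq_one {K : ℕ} {c : ℕ → Fin (K + 1) → ℕ} {lam : Fin K → ℝ}
    (hfirst : ∀ n, c n 0 = 0) (hlast : ∀ n, c n (Fin.last K) = n)
    (hmono : ∀ᶠ n in atTop, StrictMono (c n))
    (hlim : ∀ k : Fin K,
      Tendsto (fun n => ((c n k.succ - c n k.castSucc : ℕ) : ℝ) / n) atTop (nhds (lam k))) :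
    ∑ k, lam k = 1 := by
  refine tendsto_nhds_unique (tendsto_finsetSum Finset.univ fun k _ => hlim k)
    (tendsto_const_nhds.congr' ?_)
  filter_upwards [hmono, eventually_gt_atTop 0] with n hn hpos
  have h := sum_sum_Ico_castSucc_succ hn.monotone fun _ => (1 : ℝ)
  simp only [Finset.sum_const, Nat.card_Ico, nsmul_eq_mul, mul_one, hfirst, hlast,
    Nat.sub_zero] at h
  rw [← Finset.sum_div, h, div_self (by exact_mod_cast hpos.ne')]

theorem theorem1 {Ω : Type*} [MeasurableSpace Ω] (P : Measure Ω) [IsProbabilityMeasure P]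
    (L K : ℕ) (X : ℕ → Ω → Fin L → ℝ)
    (hindep : iIndepFun X P)
    (hident : ∀ i, IdentDistrib (X i) (X 0) P P)
    (hcont : ∀ l : Fin L, Continuous (cdf (P.map fun ω => X 0 ω l)))
    (hSigma : IsUnit (gradeCov P (X 0)))
    (c : ℕ → Fin (K + 1) → ℕ)
    (hfirst : ∀ n, c n 0 = 0)
    (hlast : ∀ n, c n (Fin.last K) = n)
    (lam : Fin K → ℝ)
    (hlam : ∀ k, lam k ∈ Set.Ioo (0 : ℝ) 1)
    (hlim : ∀ k : Fin K,
      Tendsto (fun n => ((c n k.succ : ℝ) - c n k.castSucc) / n) atTop (nhds (lam k))) :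
    TendstoInDistribution (fun n ω => kruskalWallis n (c n) (fun i => X i ω)) atTop
      (id : ℝ → ℝ) (fun _ => P) (chiSquared ((K - 1) * L)) := by
  have hX := fun i => (hident i).aemeasurable_fst
  have hseq := aemeasurable_sequence hident
  have hmono := eventually_strictMono (fun k => (hlam k).1) hlim
  have hratio := tendsto_groupSize_div hmono hlim
  have hsize := fun k => tendsto_groupSize (fun k => (hlam k).1) (hratio k)
  have hsum := sum_lam_eq_one hfirst hlast hmono hratio
  obtain ⟨B, hB⟩ := (posSemidef_gradeCov (hX 0) hcont).exists_eq_mul_transpose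
  -- Invertibility of `Σ` passes to its factor `B`, which allows standardizing the grades by `B⁻¹`.
  have hunit : IsUnit B := isUnit_of_mul_isUnit_left (hB ▸ hSigma)
  have hdet := (Matrix.isUnit_iff_isUnit_det B).1 hunit
  set μ : Fin L → Measure ℝ := fun l => P.map fun ω => X 0 ω l
  let std : (Fin L → ℝ) → Fin L → ℝ := fun v => B⁻¹ *ᵥ centredGrade μ v
  have hgrade : ∀ l, Measurable fun v => centredGrade μ v l := fun l =>
    (measurable_pi_apply l).comp (measurable_centredGrade μ)
  have hstd : Measurable std := measurable_pi_lambda _ fun l => by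
    simp only [std, mulVec, dotProduct]
    exact Finset.measurable_fun_sum _ fun a _ => (hgrade a).const_mul _
  have hgradeL2 : ∀ l, MemLp (fun ω => centredGrade μ (X 0 ω) l) 2 P := fun l =>
    MemLp.of_bound ((hgrade l).comp_aemeasurable (hX 0)).aestronglyMeasurable 1
      (Eventually.of_forall fun ω => abs_centredGrade_le μ _ l)
  have hclt := tendstoInDistribution_groupSums (hmono.mono fun n hn => hn.monotone) hsize
    (V := fun i ω => std (X i ω)) (hindep.comp _ fun _ => hstd) (fun i => (hident i).comp hstd)
    (fun l => memLp_finsetSum Finset.univ fun a _ => (hgradeL2 a).const_mul (B⁻¹ l a))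
    (fun l => by
      simp only [std, mulVec, dotProduct]
      rw [integral_finsetSum _ fun a _ => ((hgradeL2 a).integrable one_le_two).const_mul _]
      refine Finset.sum_eq_zero fun a _ => ?_
      rw [integral_const_mul, integral_centredGrade (hX 0) hcont, mul_zero])
    (integral_standardized_mul (hX 0) hcont hB hunit)
  have hrem : TendstoInMeasure P (fun n ω (k : Fin K) (l : Fin L) =>
      degenerateRemainder μ n (c n k.castSucc) (c n k.succ) (fun i => X i ω) l) atTop
      (fun _ => 0) := by
    refine TendstoInMeasure.pi fun k => TendstoInMeasure.pi fun l => ?_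
    refine tendstoInMeasure_degenerateRemainder hindep hident hcont
      (a := fun n => c n k.castSucc) (b := fun n => c n k.succ) ?_ l
    filter_upwards [hmono] with n hn
    exact (Nat.sub_le _ _).trans ((hn.monotone (Fin.le_last _)).trans (hlast n).le)
  have hprop : TendstoInMeasure P (fun n (_ : Ω) (k : Fin K) =>
      √(((c n k.succ - c n k.castSucc : ℕ) : ℝ) / n)) atTop (fun _ k => √(lam k)) :=
    tendstoInMeasure_const_of_tendsto (tendsto_pi_nhds.2 fun k => (hratio k).sqrt)
  have hinv : TendstoInMeasure P (fun n ω (l l' : Fin L) => (rankCov n fun i => X i ω)⁻¹ l l')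
      atTop (fun _ l l' => (gradeCov P (X 0))⁻¹ l l') :=
    TendstoInMeasure.continuousAt_comp (continuousAt_inv_matrix hSigma)
      (Y := fun n ω l l' => rankCov n (fun i => X i ω) l l')
      (TendstoInMeasure.pi fun l => TendstoInMeasure.pi fun l' =>
        tendstoInMeasure_rankCov hindep hident hcont l l')
  -- Slutsky's theorem: the group sums converge in law, while the remainder, the root proportions
  -- and the inverse rank covariance converge in probability to constants.
  have hslutsky := hclt.continuous_comp_prodMk_of_tendstoInMeasure_const
    (continuous_residualForm B) (TendstoInMeasure.prodMk hrem (TendstoInMeasure.prodMk hprop hinv))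
    (fun n => (aemeasurable_pi_lambda _ fun k => aemeasurable_pi_lambda _ fun l =>
        (measurable_degenerateRemainder μ n _ _ l).comp_aemeasurable hseq).prodMk
      (aemeasurable_const.prodMk (aemeasurable_pi_lambda _ fun l => aemeasurable_pi_lambda _
        fun l' => (measurable_inv_rankCov n l l').comp_aemeasurable hseq)))
  have hlaw : (stdGaussian (EuclideanSpace ℝ (Fin K × Fin L))).map
      (fun w => residualForm B (id w, 0, (fun k => √(lam k)),
        fun l l' => (gradeCov P (X 0))⁻¹ l l')) = chiSquared ((K - 1) * L) := by
    simp only [id, residualForm_zero_inv hB hunit]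
    refine map_residual_stdGaussian ?_
    rw [← hsum]
    exact Finset.sum_congr rfl fun k _ => Real.sq_sqrt (hlam k).1.le
  -- The statistic equals the form in `hslutsky` only once all groups are nonempty, hence only for
  -- large `n`.
  refine TendstoInDistribution.congr_eventually
    (TendstoInDistribution.of_map_eq hslutsky hlaw)
    (fun n => (measurable_kruskalWallis n (c n)).comp_aemeasurable hseq) ?_
  filter_upwards [hmono] with n hn
  refine Eventually.of_forall fun ω => ?_
  have hBstd : (fun j => centredGrade μ (X j ω)) = fun j => B *ᵥ std (X j ω) := by
    funext j
    simp only [std, Matrix.mulVec_mulVec, Matrix.mul_nonsing_inv B hdet, Matrix.one_mulVec]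
  have hrow : ∀ k : Fin K, (fun l => √((c n k.succ - c n k.castSucc : ℕ) : ℝ) * (n : ℝ)⁻¹ *
      centredRankMean n (fun i => X i ω) (c n k.castSucc) (c n k.succ) l) =
      B *ᵥ arrayResidual (fun k => √(((c n k.succ - c n k.castSucc : ℕ) : ℝ) / n))
        (groupSums (c n) fun i => std (X i ω)) k + fun l =>
          degenerateRemainder μ n (c n k.castSucc) (c n k.succ) (fun i => X i ω) l := fun k => by
    funext l
    rw [normalized_centredRankMean_eq μ hn (hfirst n) (hlast n), hBstd, Pi.add_apply]
    congr 1
    simp only [groupSums_mulVec, mulVec, dotProduct, arrayResidual, mul_sub,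
      Finset.sum_sub_distrib, Finset.mul_sum]
    congr 1
    rw [Finset.sum_comm]
    exact Finset.sum_congr rfl fun a _ => Finset.sum_congr rfl fun b _ => by ring
  simp only [kruskalWallis_eq_sum hn.monotone, hrow]
  rfl
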